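/- **Setting.** Let $V$ be a finite set, $\mathcal I=\prod_{\gamma\in V}\mathcal I_\gamma$ with finite nonempty level sets $\mathcal I_\gamma$, and let $i^*\in\mathcal I$ be a reference cell. For $D\subseteq V$ put $\mathcal I_D=\prod_{\gamma\in D}\mathcal I_\gamma$ and write $p^D(i_D)$ and $p^{R\mid i_S}(i_R)=p^{R\cup S}(i_R,i_S)/p^S(i_S)$ for the marginal and conditional probabilities of a table $p=(p(i))_{i\in\mathcal I}$. Let $G$ be a decomposable graph on $V$, and $N\ge 1$. The model $\mathcal M_G$ is the set of multinomial distributions $\mathcal M(N,p)$ of the counts $(n(i))_{i\in\mathcal I}$, with $p>0$, $\sum_i p(i)=1$, and $p$ Markov with respect to $G$ ($X_\gamma$ and $X_\delta$ are conditionally independent given the other variables if $\gamma\ne\delta$ are not adjacent). Let $A\subseteq V$ be a *cut*: the model is collapsible onto $A$, i.e. the $A$-marginals of the Markov tables for $G$ are exactly the Markov tables for the induced graph $G_A$. A *clique* is a maximal complete set. For an ordering $C_1,\dots,C_k$ of the cliques of a graph put $S_l=C_l\cap\bigcup_{i<l}C_i$ and $R_l=C_l\setminus S_l$ for $l\ge2$;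 the ordering is *perfect* if for each $l\ge 2$ there is $i<l$ with $S_l\subseteq C_i$. Let $C'_1,\dots,C'_q$ be a perfect ordering of the cliques of $G_A$, with separators $S'_l$ and residuals $R'_l$. Let $B_1,\dots,B_p$ be the connected components of $G_{V\setminus A}$, let $\partial B_l$ be the set of vertices outside $B_l$ that have a neighbour in $B_l$, and let $C^{(l)}_1,\dots,C^{(l)}_{m_l}$ be a perfect ordering of the cliques of $G_{B_l\cup\partial B_l}$ with $\partial B_l\subseteq C^{(l)}_1$, with separators $S^{(l)}_j$ and residuals $R^{(l)}_j$. Let $p_A^{cut}$ be made of the following groups: 1. $p^{C'_1}$, and $p^{R'_l\mid i_{S'_l}}$ for $2\le l\le q$, $i_{S'_l}\in\mathcal I_{S'_l}$; 2. for $1\le l\le p$: $p^{C^{(l)}_1\setminus\partial B_l\mid i_{\partial B_l}}$ for $i_{\partial B_l}\in\mathcal I_{\partial B_l}$, and $p^{R^{(l)}_j\mid i_{S^{(l)}_j}}$ for $2\le j\le m_l$, $i_{S^{(l)}_j}\in\mathcal I_{S^{(l)}_j}$. Each listed probability table is one group; its free coordinates are its entries other than the one at the reference cell. **Reference priors.**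 Consider a regular model with parameter $\theta=(\theta_1,\dots,\theta_m)$, the groups $\theta_j$ in their order of inferential importance, parameter space $\prod_j\Theta_j$ and Fisher information matrix $I(\theta)$. Let $h_j(\theta)$ be the diagonal block belonging to $\theta_j$ of the inverse of the upper left corner of $I(\theta)^{-1}$ that belongs to $\theta_1,\dots,\theta_j$. On a compact rectangle $\prod_j\kappa_j$ define, for $j=m,\dots,1$, $$\pi(\theta_j,\dots,\theta_m\mid\theta_{1},\dots,\theta_{j-1})=\pi(\theta_{j+1},\dots,\theta_m\mid\theta_1,\dots,\theta_j)\,\frac{v_j}{\int v_j\,d\theta_j},\qquad v_j=\mathbf 1_{\kappa_j}(\theta_j)\exp\Big(\tfrac12E\big[\log\det h_j(\theta)\mid\theta_1,\dots,\theta_j\big]\Big),$$ the expectation being with respect to $\pi(\theta_{j+1},\dots,\theta_m\mid\theta_1,\dots,\theta_j)$. A positive function $\pi^R$ on $\prod_j\Theta_j$ is the reference prior (up to a constant factor) if for all nested sequences of compact rectangles $K_n=\prod_j\kappa_{n,j}$ with $\bigcup_n\kappa_{n,j}=\Theta_j$ for each $j$, the resulting densities $\pi_n$ satisfy $\pi_n(\theta)/\pi_n(\theta^0)\to\pi^R(\theta)/\pi^R(\theta^0)$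 for all $\theta,\theta^0\in\prod_j\Theta_j$. (Such sequences are required to exist.) **Theorem.** The map $p\mapsto p_A^{cut}$ is a bijection from the Markov tables for $G$ onto the product of the open simplices of the groups. For every ordering of the groups, the parametrization of $\mathcal M_G$ by $p^{cut}_A$ is regular (the probability function is positive and differentiable in the parameter, with positive definite Fisher information), and the reference prior for $p^{cut}_A$ is $$\pi^R(p_A^{cut})\propto\prod_{i_{C_1'}}p^{C_1'}(i_{C_1'})^{-\frac12}\prod_{l=2}^q\prod_{i_{S_l'}}\prod_{i_{R_l'}}p^{R_l'\mid i_{S_l'}}(i_{R_l'})^{-\frac12}\times\prod_{l=1}^p\Big(\prod_{i_{\partial B_l}}\prod_{i_{C_1^{(l)}\setminus\partial B_l}}p^{C_1^{(l)}\setminus\partial B_l\mid i_{\partial B_l}}(i_{C_1^{(l)}\setminus\partial B_l})^{-\frac12}\prod_{j=2}^{m_l}\prod_{i_{S_j^{(l)}}}\prod_{i_{R_j^{(l)}}}p^{R_j^{(l)}\mid i_{S_j^{(l)}}}(i_{R_j^{(l)}})^{-\frac12}\Big).$$ -/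

import Mathlib

/-!
# Discrete graphical models, cuts, and grouped reference priors

Part 1 defines (Berger--Bernardo) reference priors for a parameter that is split into ordered
groups.  Part 2 defines multinomial models that are Markov with respect to a graph, decomposable
graphs, perfect orderings of cliques and cuts.  Part 3 defines the parametrization of such a model
by the conditional tables that belong to a cut.
-/

noncomputable section

namespace RefPrior

open MeasureTheory Filter Topology

/-! ## Part 1: reference priors for grouped parameters

The groups are indexed by `J`; the group `j` is a vector of `ℝ^(D j)` that ranges over `Θ j`, and
the parameter space is the product of the sets `Θ j`. -/

section Reference

variable {J : Type*} [Fintype J] [DecidableEq J] {D : J → Type*} [∀ j, Fintype (D j)]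
  [∀ j, DecidableEq (D j)] {X : Type*}

/-- The score: the partial derivative of the log-likelihood `θ ↦ log f(x | θ)` with respect to the
scalar coordinate `a.2` of the group `a.1`. -/
def score (f : X → (∀ j, D j → ℝ) → ℝ) (x : X) (θ : ∀ j, D j → ℝ) (a : Σ j, D j) : ℝ :=
  fderiv ℝ (fun η => Real.log (f x η)) θ (Pi.single a.1 (Pi.single a.2 1))

/-- The Fisher information matrix `E_θ [score · scoreᵀ]` of the model with finite sample space `𝒳`
and probability function `x ↦ f(x | θ)`. -/
def fisherInfo (𝒳 : Finset X) (f : X → (∀ j, D j → ℝ) → ℝ) (θ : ∀ j, D j → ℝ) :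
    Matrix (Σ j, D j) (Σ j, D j) ℝ :=
  Matrix.of fun a b => ∑ x ∈ 𝒳, f x θ * score f x θ a * score f x θ b

/-- Regular models: for each `θ` in the parameter space `f(· | θ)` is a strictly positive
probability function on `𝒳`, differentiable in the parameter, with positive definite Fisher
information matrix. -/
structure IsRegularModel (𝒳 : Finset X) (f : X → (∀ j, D j → ℝ) → ℝ)
    (Θ : ∀ j, Set (D j → ℝ)) : Prop where
  pos : ∀ θ, (∀ j, θ j ∈ Θ j) → ∀ x ∈ 𝒳, 0 < f x θ
  sum_eq_one : ∀ θ, (∀ j, θ j ∈ Θ j) → ∑ x ∈ 𝒳, f x θ = 1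
  differentiableAt : ∀ θ, (∀ j, θ j ∈ Θ j) → ∀ x ∈ 𝒳, DifferentiableAt ℝ (f x) θ
  posDef : ∀ θ, (∀ j, θ j ∈ Θ j) → (fisherInfo 𝒳 f θ).PosDef

/-- The matrix `h_j` of the reference-prior algorithm, where `rest` lists the groups after `j`:
let `S` be the inverse of the information matrix `M`, let `S_j` be the corner of `S` that belongs
to the groups up to and including `j`, and let `H_j` be its inverse; then `h_j` is the diagonal
block of `H_j` that belongs to the group `j`. -/
def refBlock (M : Matrix (Σ j, D j) (Σ j, D j) ℝ) (j : J) (rest : List J) :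
    Matrix (D j) (D j) ℝ :=
  let upTo := {a : Σ i, D i // a.1 = j ∨ a.1 ∉ rest}
  let Sj : Matrix upTo upTo ℝ := M⁻¹.submatrix Subtype.val Subtype.val
  let emb : D j → upTo := fun r => ⟨⟨j, r⟩, Or.inl rfl⟩
  Sj⁻¹.submatrix emb emb

/-- The parameter obtained from `θ` when the groups in `rest` are replaced by `u`. -/
def replaceGroups (rest : List J) (θ : ∀ j, D j → ℝ) (u : ∀ i : {i // i ∈ rest}, D i → ℝ) :
    ∀ j, D j → ℝ :=
  fun i => if h : i ∈ rest then u ⟨i, h⟩ else θ i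

/-- The backward recursion of the reference-prior algorithm on a compact rectangle `∏ j, κ j`.
`info` is the information matrix as a function of the parameter.  If `L` lists the last groups
`θ_j, …, θ_m` in their order, then `refDensity info κ L θ` is the density
`π(θ_j, …, θ_m | θ_1, …, θ_{j-1})`.  It is `1` for no group, and
`π(θ_j, …, θ_m | θ_1, …, θ_{j-1}) = π(θ_{j+1}, …, θ_m | θ_1, …, θ_j) · v_j(θ) / ∫ v_j dθ_j`,
`v_j(θ) = 1(θ_j ∈ κ_j) · exp (½ · E[log det h_j(θ) | θ_1, …, θ_j])`, where the expectation is over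
`θ_{j+1}, …, θ_m` with respect to `π(θ_{j+1}, …, θ_m | θ_1, …, θ_j)`. -/
def refDensity (info : (∀ j, D j → ℝ) → Matrix (Σ j, D j) (Σ j, D j) ℝ)
    (κ : ∀ j, Set (D j → ℝ)) : List J → (∀ j, D j → ℝ) → ℝ
  | [], _ => 1
  | j :: rest, θ =>
    let v : (∀ j, D j → ℝ) → ℝ := fun η =>
      (κ j).indicator (fun _ =>
        Real.exp ((1 / 2 : ℝ) * ∫ u : (∀ i : {i // i ∈ rest}, D i → ℝ),
          Real.log (refBlock (info (replaceGroups rest η u)) j rest).det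
            * refDensity info κ rest (replaceGroups rest η u))) (η j)
    refDensity info κ rest θ * (v θ / ∫ t : D j → ℝ, v (Function.update θ j t))

/-- A nested sequence of compact rectangles that exhausts the parameter space `∏ j, Θ j`. -/
structure IsCompactExhaustion (Θ : ∀ j, Set (D j → ℝ)) (κ : ℕ → ∀ j, Set (D j → ℝ)) :
    Prop where
  compact : ∀ n j, IsCompact (κ n j)
  nested : ∀ n j, κ n j ⊆ κ (n + 1) j
  exhausts : ∀ j, ⋃ n, κ n j = Θ j

/-- `π` is (up to a constant factor) the reference prior, as a density with respect to Lebesgue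
measure on `∏ j, Θ j`, of the model `f` for the groups `J` in the order of inferential importance
given by the list `L`: the model is regular, `π` is positive, and for the exhaustions of the
parameter space by compact rectangles (there are some) and the prior densities `π_n` which the
recursion gives on them, `π_n(θ) / π_n(θ₀) → π(θ) / π(θ₀)` for all parameters `θ, θ₀`. -/
structure IsReferencePrior (𝒳 : Finset X) (f : X → (∀ j, D j → ℝ) → ℝ)
    (Θ : ∀ j, Set (D j → ℝ)) (L : List J) (π : (∀ j, D j → ℝ) → ℝ) : Prop where
  regular : IsRegularModel 𝒳 f Θ
  pos : ∀ θ, (∀ j, θ j ∈ Θ j) → 0 < π θ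
  exists_exhaustion : ∃ κ : ℕ → ∀ j, Set (D j → ℝ), IsCompactExhaustion Θ κ
  tendsto : ∀ κ : ℕ → ∀ j, Set (D j → ℝ), IsCompactExhaustion Θ κ →
    ∀ θ θ₀, (∀ j, θ j ∈ Θ j) → (∀ j, θ₀ j ∈ Θ j) →
      Tendsto (fun n => refDensity (fisherInfo 𝒳 f) (κ n) L θ
          / refDensity (fisherInfo 𝒳 f) (κ n) L θ₀) atTop (𝓝 (π θ / π θ₀))

end Reference

/-! ## Part 2: discrete graphical models -/

section Graphical

/-- Cells of the `S`-marginal table. -/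
abbrev Cell {V : Type*} (I : V → Type*) (S : Finset V) := ∀ γ : {γ // γ ∈ S}, I γ

variable {V : Type*} [Fintype V] [DecidableEq V] {I : V → Type*} [∀ γ, Fintype (I γ)]
  [∀ γ, DecidableEq (I γ)]

/-- The marginal probability `p^S(i_S)`. -/
def marginal (p : (∀ γ, I γ) → ℝ) (S : Finset V) (s : Cell I S) : ℝ :=
  ∑ i with S.restrict i = s, p i

/-- The conditional probability `p^{R | i_S}(i_R)`. -/
def conditional (p : (∀ γ, I γ) → ℝ) (R S : Finset V) (s : Cell I S) (r : Cell I R) : ℝ :=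
  (∑ i with R.restrict i = r ∧ S.restrict i = s, p i) / marginal p S s

/-- The strictly positive probability tables that are Markov with respect to `G`: `X_γ` and `X_δ`
are conditionally independent given the other variables whenever `γ ≠ δ` are not adjacent. -/
def markovModel (G : SimpleGraph V) : Set ((∀ γ, I γ) → ℝ) :=
  {p | (∀ i, 0 < p i) ∧ ∑ i, p i = 1 ∧
    ∀ γ δ, γ ≠ δ → ¬ G.Adj γ δ → ∀ i : ∀ γ, I γ,
      p i * marginal p (Finset.univ \ {γ, δ}) (Finset.restrict _ i)
        = marginal p (Finset.univ \ {γ}) (Finset.restrict _ i)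
          * marginal p (Finset.univ \ {δ}) (Finset.restrict _ i)}

/-- `A` is a cut: the model Markov with respect to `G` is collapsible onto `A`, that is, the
`A`-marginals of its members are exactly the tables Markov with respect to the induced graph
`G_A`. -/
def IsCut (I : V → Type*) [∀ γ, Fintype (I γ)] [∀ γ, DecidableEq (I γ)]
    (G : SimpleGraph V) (A : Finset V) : Prop :=
  (fun p : (∀ γ, I γ) → ℝ => marginal p A) '' markovModel G
    = markovModel (I := fun γ : {γ // γ ∈ A} => I γ) (G.comap Subtype.val)

/-- Probability function of the multinomial distribution `M(N, p)`, `N = ∑ i, n i`. -/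
def multinomialProb {ι : Type*} [Fintype ι] (p : ι → ℝ) (n : ι → ℕ) : ℝ :=
  (Nat.multinomial Finset.univ n : ℝ) * ∏ i, p i ^ n i

/-- The subgraph of `G` induced by a vertex set is decomposable: it is complete, or its vertex set
is the disjoint union of `a`, `b` (not empty) and a complete set `c` that separates `a` from `b`,
such that the subgraphs induced by `a ∪ c` and `b ∪ c` are decomposable. -/
inductive IsDecomposableOn (G : SimpleGraph V) : Finset V → Prop
  | complete (s : Finset V) : G.IsClique (s : Set V) → IsDecomposableOn G s
  | glue (a b c : Finset V) : a.Nonempty → b.Nonempty → Disjoint a b → Disjoint a c →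
      Disjoint b c → G.IsClique (c : Set V) → (∀ x ∈ a, ∀ y ∈ b, ¬ G.Adj x y) →
      IsDecomposableOn G (a ∪ c) → IsDecomposableOn G (b ∪ c) → IsDecomposableOn G (a ∪ b ∪ c)

/-- `G` is a decomposable graph. -/
def IsDecomposable (G : SimpleGraph V) : Prop := IsDecomposableOn G Finset.univ

/-- `K` is a clique, that is a maximal complete vertex set, of the subgraph induced by `U`. -/
def IsCliqueOf (G : SimpleGraph V) (U K : Finset V) : Prop :=
  Maximal (fun K : Finset V => K ⊆ U ∧ G.IsClique (K : Set V)) K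

/-- `⋃_{i < l} C_i`. -/
def history {k : ℕ} (C : Fin k → Finset V) (l : Fin k) : Finset V :=
  (Finset.univ.filter (· < l)).biUnion C

/-- `C` lists the cliques of the subgraph induced by `U`, each once, in a perfect order. -/
structure IsPerfectOrdering (G : SimpleGraph V) (U : Finset V) {k : ℕ} (C : Fin k → Finset V) :
    Prop where
  injective : Function.Injective C
  mem_range_iff : ∀ K, K ∈ Set.range C ↔ IsCliqueOf G U K
  perfect : ∀ l : Fin k, (l : ℕ) ≠ 0 → ∃ i < l, C l ∩ history C l ⊆ C i

/-- The set on which the `l`-th clique is conditioned: the separator `S_l = C_l ∩ ⋃_{i < l} C_i`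
for every clique but the first, and the given set `F` for the first clique. -/
def separator (F : Finset V) {k : ℕ} (C : Fin k → Finset V) (l : Fin k) : Finset V :=
  if (l : ℕ) = 0 then F else C l ∩ history C l

/-- The rest of the `l`-th clique: `C_1 \ F` for the first clique, the residual
`R_l = C_l \ S_l` for the other ones. -/
def residual (F : Finset V) {k : ℕ} (C : Fin k → Finset V) (l : Fin k) : Finset V :=
  C l \ separator F C l

/-- `B` is (the vertex set of) a connected component of the subgraph induced by `V \ A`. -/
def IsComponentOff (G : SimpleGraph V) (A B : Finset V) : Prop :=
  ∃ c : (G.induce {v | v ∉ A}).ConnectedComponent, (B : Set V) = Subtype.val '' c.supp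

open Classical in
/-- The boundary `∂B`: the vertices outside `B` with a neighbour in `B`. -/
def boundary (G : SimpleGraph V) (B : Finset V) : Finset V :=
  {v | v ∉ B ∧ ∃ w ∈ B, G.Adj v w}

end Graphical

/-! ## Part 3: the parametrization associated to a cut -/

section Cut

variable {V : Type*} [Fintype V] [DecidableEq V]

/-- The enumerations on which the parametrization depends: a perfect ordering
`CA 0, …, CA (q - 1)` of the cliques of `G_A`; the connected components `B 0, …, B (p - 1)` of
`G_{V \ A}`; and for each of them a perfect ordering `CB l 0, …, CB l (m l - 1)` of the cliques of
the subgraph induced by `B l ∪ ∂(B l)`, the first of which contains `∂(B l)`. -/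
structure CutOrdering (G : SimpleGraph V) (A : Finset V) where
  q : ℕ
  CA : Fin q → Finset V
  perfectA : IsPerfectOrdering G A CA
  p : ℕ
  B : Fin p → Finset V
  injective_B : Function.Injective B
  mem_range_B : ∀ K, K ∈ Set.range B ↔ IsComponentOff G A K
  m : Fin p → ℕ
  CB : ∀ l, Fin (m l) → Finset V
  perfectB : ∀ l, IsPerfectOrdering G (B l ∪ boundary G (B l)) (CB l)
  boundary_subset : ∀ l (j : Fin (m l)), (j : ℕ) = 0 → boundary G (B l) ⊆ CB l j

variable (I : V → Type*) [∀ γ, Fintype (I γ)] [∀ γ, DecidableEq (I γ)]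
  {G : SimpleGraph V} {A : Finset V}

namespace CutOrdering

/-- Index set of the groups of parameters.  The groups of the first kind are the table `p^{C'_1}`
(conditioned on the only cell of the empty set of variables) and the tables `p^{R'_l | i_{S'_l}}`
for `l ≥ 2`.  Those of the second kind are, for each component `B_l`, the tables
`p^{C_1^{(l)} \ ∂B_l | i_{∂B_l}}` and the tables `p^{R_j^{(l)} | i_{S_j^{(l)}}}` for `j ≥ 2`. -/
abbrev Group (c : CutOrdering G A) :=
  (Σ l : Fin c.q, Cell I (separator ∅ c.CA l)) ⊕
    (Σ l : Fin c.p, Σ j : Fin (c.m l), Cell I (separator (boundary G (c.B l)) (c.CB l) j))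

variable {I}

/-- The variables on which the table of a group is conditioned. -/
def sep (c : CutOrdering G A) : c.Group I → Finset V
  | .inl x => separator ∅ c.CA x.1
  | .inr x => separator (boundary G (c.B x.1)) (c.CB x.1) x.2.1

/-- The cell of these variables. -/
def slice (c : CutOrdering G A) : (g : c.Group I) → Cell I (c.sep g)
  | .inl x => x.2
  | .inr x => x.2.2

/-- The variables of the table of a group. -/
def res (c : CutOrdering G A) : c.Group I → Finset V
  | .inl x => residual ∅ c.CA x.1
  | .inr x => residual (boundary G (c.B x.1)) (c.CB x.1) x.2.1

/-- The free scalar parameters of a group: its cells except the reference cell, which is the one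
given by `istar`. -/
abbrev Coord (c : CutOrdering G A) (istar : ∀ γ, I γ) (g : c.Group I) :=
  {r : Cell I (c.res g) // r ≠ Finset.restrict (c.res g) istar}

/-- The parametrization `p^cut_A`: each group is the conditional table it stands for. -/
def param (c : CutOrdering G A) (istar : ∀ γ, I γ) (p : (∀ γ, I γ) → ℝ) :
    ∀ g : c.Group I, c.Coord istar g → ℝ :=
  fun g r => conditional p (c.res g) (c.sep g) (c.slice g) r.1

/-- The range of a group: the open simplex, in terms of the free coordinates. -/
def simplex (c : CutOrdering G A) (istar : ∀ γ, I γ) (g : c.Group I) :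
    Set (c.Coord istar g → ℝ) :=
  {t | (∀ r, 0 < t r) ∧ ∑ r, t r < 1}

/-- The whole table of a group, the reference cell included. -/
def table (c : CutOrdering G A) (istar : ∀ γ, I γ) (θ : ∀ g : c.Group I, c.Coord istar g → ℝ)
    (g : c.Group I) (r : Cell I (c.res g)) : ℝ :=
  if h : r ≠ Finset.restrict (c.res g) istar then θ g ⟨r, h⟩ else 1 - ∑ x, θ g x

/-- The table of joint probabilities in the model `M_G` that has the parameter `θ`. -/
def joint (c : CutOrdering G A) (istar : ∀ γ, I γ)
    (θ : ∀ g : c.Group I, c.Coord istar g → ℝ) : (∀ γ, I γ) → ℝ :=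
  haveI : Nonempty ((∀ γ, I γ) → ℝ) := ⟨0⟩
  Function.invFunOn (c.param istar) (markovModel G) θ

/-- The product, over all tables of the parametrization, of the kernel
`∏ (cell probability)^(-1/2)`. -/
def jeffreysProduct (c : CutOrdering G A) (istar : ∀ γ, I γ)
    (θ : ∀ g : c.Group I, c.Coord istar g → ℝ) : ℝ :=
  (∏ l : Fin c.q, ∏ s : Cell I (separator ∅ c.CA l),
      ∏ r : Cell I (residual ∅ c.CA l), c.table istar θ (.inl ⟨l, s⟩) r ^ (-(1 / 2) : ℝ)) *
    ∏ l : Fin c.p, ∏ j : Fin (c.m l),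
      ∏ s : Cell I (separator (boundary G (c.B l)) (c.CB l) j),
        ∏ r : Cell I (residual (boundary G (c.B l)) (c.CB l) j),
          c.table istar θ (.inr ⟨l, j, s⟩) r ^ (-(1 / 2) : ℝ)

end CutOrdering

end Cut

end RefPrior

end

/-!
# Reference priors of decomposable models parametrized along a cut

The cliques of `G_A`, followed by the cliques of the graphs induced by the sets `B_l ∪ ∂B_l`, form
one perfect sequence of complete sets of `G` (`CutOrdering.isPerfectSequence`).  The point is that
`∂B_l` is complete, being contained in a clique, so that it lies in some clique of `G_A`; hence
each component is attached to what precedes it along a complete separator.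

Along a perfect sequence the product `p_θ` of arbitrary positive conditional tables is a
probability table, because the residuals can be summed out in reverse order
(`IsPerfectSequence.sum_chainProd`).  This identity between polynomials in the tables is perturbed
to get everything else about `p_θ`: its conditional tables are the given ones, the scores of
different tables are orthogonal, and the probability of the cell on which a table is conditioned
does not depend on that table.  Since the sets of the sequence are complete, `p_θ` factorizes over
complete sets and is Markov; this gives surjectivity of the parametrization.  For injectivity, two
Markov tables with the same conditional tables have the same marginals on complete sets, and their
logarithms have no interactions between vertices that are not adjacent, so that
`∑ (p - p') (log p - log p') = 0`, which forces `p = p'` (`markovModel_ext`).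

By orthogonality the Fisher information is block diagonal.  The block of the group `g` is
`N p^S(i_S)` times the information matrix of a single table (`CutOrdering.fisherInfo_of_eq`), whose
determinant is the inverse of the product of the cell probabilities.  So `log det h_g` is the sum of
a function of the other groups and of a function of the group `g`.  In the backward recursion the
expectation of the former is constant in the group `g` and cancels in the normalisation; therefore
the recursion yields, on every rectangle and for every order of the groups, the product of the
normalised Jeffreys weights of the tables (`refDensity_eq_prod`).
-/

namespace RefPrior

open MeasureTheory Filter Topology

/-! ### Reference priors for orthogonal groups of parameters -/

section Reference

variable {J : Type*} [DecidableEq J] {D : J → Type*} [∀ j, Fintype (D j)]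
  [∀ j, DecidableEq (D j)]

/-- For orthogonal groups the corners of the inverse of the information matrix are the inverses of
its corners, so `h_j` is just the diagonal block of the group `j`. -/
theorem refBlock_eq_submatrix [Fintype J] {M : Matrix (Σ j, D j) (Σ j, D j) ℝ}
    (hM : ∀ a b, a.1 ≠ b.1 → M a b = 0) (hdet : IsUnit M.det) (j : J) (rest : List J) :
    refBlock M j rest = M.submatrix (Sigma.mk j) (Sigma.mk j) := by
  set upTo := {a : Σ i, D i // a.1 = j ∨ a.1 ∉ rest}
  have key : (M⁻¹.submatrix Subtype.val Subtype.val : Matrix upTo upTo ℝ)⁻¹ =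
      M.submatrix Subtype.val Subtype.val := by
    apply Matrix.inv_eq_right_inv
    ext a b
    have h1 : (M⁻¹ * M) a.1 b.1 = (1 : Matrix upTo upTo ℝ) a b := by
      rw [Matrix.nonsing_inv_mul _ hdet]
      by_cases h : a = b
      · rw [h, Matrix.one_apply_eq, Matrix.one_apply_eq]
      · rw [Matrix.one_apply_ne h, Matrix.one_apply_ne fun e => h (Subtype.ext e)]
    rw [← h1, Matrix.mul_apply, Matrix.mul_apply]
    simp only [Matrix.submatrix_apply]
    -- The terms outside the corner vanish, because `M` is block diagonal.
    have h2 : ∀ x : Σ i, D i, x ∉ Finset.univ.filter (fun a : Σ i, D i => a.1 = j ∨ a.1 ∉ rest) →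
        M⁻¹ a.1 x * M x b.1 = 0 := by
      intro x hx
      rw [hM x b.1, mul_zero]
      intro h
      apply hx
      simp only [Finset.mem_filter, Finset.mem_univ, true_and, h]
      exact b.2
    rw [← Finset.sum_subset (Finset.subset_univ _) fun x _ hx => h2 x hx]
    exact (Finset.sum_subtype _ (by simp) (fun x => M⁻¹ a.1 x * M x b.1)).symm
  unfold refBlock
  simp only
  rw [key]
  rfl

theorem setIntegral_pos_of_isCompact {E : Type*} [TopologicalSpace E] [T2Space E]
    [MeasureSpace E] [OpensMeasurableSpace E] [IsFiniteMeasureOnCompacts (volume : Measure E)]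
    {K : Set E} (hK : IsCompact K) (hvol : volume K ≠ 0) {w : E → ℝ} (hwc : ContinuousOn w K)
    (hw : ∀ t ∈ K, 0 < w t) : 0 < ∫ t in K, w t := by
  rw [setIntegral_pos_iff_support_of_nonneg_ae _ (hwc.integrableOn_compact hK)]
  · have : Function.support w ∩ K = K := Set.inter_eq_right.2 fun t ht => (hw t ht).ne'
    rw [this]
    exact pos_iff_ne_zero.2 hvol
  · filter_upwards [ae_restrict_mem hK.measurableSet] with t ht using (hw t ht).le

/-- The normalised restriction of the weight `w` to `κ`. -/
noncomputable def normalizedWeight {E : Type*} [MeasureSpace E] (κ : Set E) (w : E → ℝ) (t : E) :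
    ℝ :=
  κ.indicator w t / ∫ s in κ, w s

/-- On a rectangle, the density given by the recursion is a product of normalised weights, if
`log det h_j` is the sum of a function that does not depend on the group `j` and of
`2 log w_j(θ_j)`: the conditional expectation of the former is a constant as far as `θ_j` is
concerned, so it cancels in the normalisation. -/
theorem refDensity_eq_prod [Fintype J] {Θ κ : ∀ j, Set (D j → ℝ)} {w : ∀ j, (D j → ℝ) → ℝ}
    {q : J → (∀ j, D j → ℝ) → ℝ}
    {info : (∀ j, D j → ℝ) → Matrix (Σ j, D j) (Σ j, D j) ℝ}
    (hinfo : ∀ θ, (∀ j, θ j ∈ Θ j) → ∀ j rest,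
      Real.log (refBlock (info θ) j rest).det = q j θ + 2 * Real.log (w j (θ j)))
    (hw : ∀ j, ∀ t ∈ Θ j, 0 < w j t) (hwc : ∀ j, ContinuousOn (w j) (Θ j))
    (hq : ∀ θ, (∀ j, θ j ∈ Θ j) → ∀ j, ∀ t ∈ Θ j, q j (Function.update θ j t) = q j θ)
    (hqc : ∀ j, ContinuousOn (q j) {θ | ∀ j, θ j ∈ Θ j})
    (hκ : ∀ j, IsCompact (κ j)) (hκΘ : ∀ j, κ j ⊆ Θ j) (hvol : ∀ j, volume (κ j) ≠ 0)
    (L : List J) (hL : L.Nodup) (θ : ∀ j, D j → ℝ) (hθ : ∀ j ∉ L, θ j ∈ Θ j) :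
    refDensity info κ L θ = ∏ j ∈ L.toFinset, normalizedWeight (κ j) (w j) (θ j) := by
  have hmeas : ∀ j, MeasurableSet (κ j) := fun j => (hκ j).measurableSet
  have hZ : ∀ j, 0 < ∫ t in κ j, w j t := fun j =>
    setIntegral_pos_of_isCompact (hκ j) (hvol j) ((hwc j).mono (hκΘ j))
      fun t ht => hw j t (hκΘ j ht)
  have hone : ∀ j, ∫ t, normalizedWeight (κ j) (w j) t = 1 := by
    intro j
    unfold normalizedWeight
    rw [integral_div, integral_indicator (hmeas j), div_self (hZ j).ne']
  induction L generalizing θ with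
  | nil => simp [refDensity]
  | cons j rest ih =>
    obtain ⟨hj, hrest⟩ := List.nodup_cons.1 hL
    have ih := ih hrest
    obtain ⟨t₀, ht₀⟩ : (κ j).Nonempty := by
      rw [Set.nonempty_iff_ne_empty]
      intro h
      exact hvol j (by simp [h])
    set ρ : (∀ i : {i // i ∈ rest}, D i → ℝ) → ℝ :=
      fun u => ∏ i : {i // i ∈ rest}, normalizedWeight (κ i) (w i) (u i) with hρ
    have hρ1 : ∫ u, ρ u = 1 := by
      rw [hρ, integral_fintype_prod_volume_eq_prod]
      simp [hone]
    have hρ0 : ∀ u, (∃ i : {i // i ∈ rest}, u i ∉ κ i) → ρ u = 0 := by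
      rintro u ⟨i, hi⟩
      exact Finset.prod_eq_zero (Finset.mem_univ i) (by simp [normalizedWeight, hi])
    have hrep : ∀ t ∈ κ j, ∀ u : (∀ i : {i // i ∈ rest}, D i → ℝ),
        (∀ i : {i // i ∈ rest}, u i ∈ κ i) →
          ∀ i, replaceGroups rest (Function.update θ j t) u i ∈ Θ i := by
      intro t ht u hu i
      unfold replaceGroups
      split_ifs with h
      · exact hκΘ _ (hu ⟨i, h⟩)
      · by_cases hij : i = j
        · subst hij
          simpa using hκΘ _ ht
        · rw [Function.update_of_ne hij]
          exact hθ i (by simp [hij, h])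
    have hrepj : ∀ (t : D j → ℝ) (u : ∀ i : {i // i ∈ rest}, D i → ℝ),
        replaceGroups rest (Function.update θ j t) u j = t := by
      intro t u
      simp [replaceGroups, hj]
    have hrepupd : ∀ (t : D j → ℝ) (u : ∀ i : {i // i ∈ rest}, D i → ℝ),
        replaceGroups rest (Function.update θ j t) u =
          Function.update (replaceGroups rest (Function.update θ j t₀) u) j t := by
      intro t u
      ext1 i
      by_cases hij : i = j
      · subst hij
        simp [replaceGroups, hj]
      · simp [replaceGroups, hij]
    have hdens : ∀ t ∈ κ j, ∀ u : (∀ i : {i // i ∈ rest}, D i → ℝ),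
        refDensity info κ rest (replaceGroups rest (Function.update θ j t) u) = ρ u := by
      intro t ht u
      rw [ih]
      · rw [hρ]
        simp only
        have hsub : ∀ g : J → ℝ, ∏ i ∈ rest.toFinset, g i = ∏ i : {i // i ∈ rest}, g i :=
          fun g => Finset.prod_subtype _ (fun _ => List.mem_toFinset) g
        rw [hsub]
        refine Finset.prod_congr rfl fun i _ => ?_
        simp [replaceGroups, i.2]
      · intro i hi
        by_cases hij : i = j
        · subst hij
          rw [hrepj]
          exact hκΘ _ ht
        · have : replaceGroups rest (Function.update θ j t) u i = θ i := by
            simp [replaceGroups, hi, hij]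
          rw [this]
          exact hθ i (by simp [hij, hi])
    set K : Set (∀ i : {i // i ∈ rest}, D i → ℝ) :=
      Set.univ.pi fun i : {i // i ∈ rest} => κ i with hK
    have hKc : IsCompact K := isCompact_univ_pi fun i : {i // i ∈ rest} => hκ i
    have hrepc : Continuous fun u : (∀ i : {i // i ∈ rest}, D i → ℝ) =>
        replaceGroups rest (Function.update θ j t₀) u := by
      refine continuous_pi fun i => ?_
      unfold replaceGroups
      split_ifs with h
      · exact continuous_apply _
      · exact continuous_const
    have hqint : Integrable fun u =>
        q j (replaceGroups rest (Function.update θ j t₀) u) * ρ u := by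
      have h1 : ContinuousOn (fun u : (∀ i : {i // i ∈ rest}, D i → ℝ) =>
          q j (replaceGroups rest (Function.update θ j t₀) u) *
            ∏ i : {i // i ∈ rest}, (w i (u i) / ∫ s in κ i, w i s)) K := by
        refine ContinuousOn.mul ?_ ?_
        · exact (hqc j).comp hrepc.continuousOn
            fun u hu => hrep t₀ ht₀ u fun i => hu i (Set.mem_univ i)
        · refine continuousOn_finsetProd _ fun i _ => ContinuousOn.div_const ?_ _
          exact (hwc i).comp (continuous_apply i).continuousOn
            fun u hu => hκΘ _ (hu i (Set.mem_univ i))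
      have h2 := (integrable_indicator_iff hKc.measurableSet).2
        (h1.integrableOn_compact (μ := volume) hKc)
      refine h2.congr (Eventually.of_forall fun u => ?_)
      simp only
      by_cases hu : u ∈ K
      · rw [Set.indicator_of_mem hu]
        congr 1
        refine Finset.prod_congr rfl fun i _ => ?_
        rw [normalizedWeight, Set.indicator_of_mem (hu i (Set.mem_univ i))]
      · rw [Set.indicator_of_notMem hu, hρ0 u, mul_zero]
        simpa [hK] using hu
    have hρint : Integrable ρ := by
      by_contra h
      rw [integral_undef h] at hρ1
      exact zero_ne_one hρ1
    set m : ℝ := ∫ u, q j (replaceGroups rest (Function.update θ j t₀) u) * ρ u with hm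
    have hE : ∀ t ∈ κ j, ∫ u : (∀ i : {i // i ∈ rest}, D i → ℝ),
        Real.log (refBlock (info (replaceGroups rest (Function.update θ j t) u)) j rest).det
          * refDensity info κ rest (replaceGroups rest (Function.update θ j t) u)
        = m + 2 * Real.log (w j t) := by
      intro t ht
      have h1 : ∀ u : (∀ i : {i // i ∈ rest}, D i → ℝ),
          Real.log (refBlock (info (replaceGroups rest (Function.update θ j t) u)) j rest).det
            * refDensity info κ rest (replaceGroups rest (Function.update θ j t) u)
          = q j (replaceGroups rest (Function.update θ j t₀) u) * ρ u
            + 2 * Real.log (w j t) * ρ u := by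
        intro u
        rw [hdens t ht]
        by_cases hu : ∀ i : {i // i ∈ rest}, u i ∈ κ i
        · rw [hinfo _ (hrep t ht u hu), hrepj, hrepupd,
            hq _ (hrep t₀ ht₀ u hu) j t (hκΘ j ht)]
          ring
        · rw [hρ0 u (by simpa using hu)]
          ring
      rw [integral_congr_ae (Eventually.of_forall h1), integral_add hqint (hρint.const_mul _),
        integral_const_mul, hρ1, mul_one]
    have hv : ∀ t, (κ j).indicator (fun _ =>
        Real.exp ((1 / 2 : ℝ) * ∫ u : (∀ i : {i // i ∈ rest}, D i → ℝ),
          Real.log (refBlock (info (replaceGroups rest (Function.update θ j t) u)) j rest).det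
            * refDensity info κ rest (replaceGroups rest (Function.update θ j t) u))) t
        = Real.exp (m / 2) * (κ j).indicator (w j) t := by
      intro t
      by_cases ht : t ∈ κ j
      · rw [Set.indicator_of_mem ht, Set.indicator_of_mem ht, hE t ht, mul_add, Real.exp_add]
        congr 1
        · congr 1
          ring
        · rw [← mul_assoc, one_div, inv_mul_cancel₀ two_ne_zero, one_mul,
            Real.exp_log (hw j t (hκΘ j ht))]
      · rw [Set.indicator_of_notMem ht, Set.indicator_of_notMem ht, mul_zero]
    have hvθ := hv (θ j)
    rw [Function.update_eq_self] at hvθ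
    rw [refDensity.eq_def]
    simp only [Function.update_self]
    rw [hvθ]
    simp only [hv]
    rw [integral_const_mul, integral_indicator (hmeas j),
      mul_div_mul_left _ _ (Real.exp_pos _).ne', List.toFinset_cons,
      Finset.prod_insert (by simpa using hj), mul_comm]
    -- Where `θ j` lies outside `κ j` the induction hypothesis need not apply to `θ`, but then the
    -- factor of the group `j` vanishes.
    by_cases hθj : θ j ∈ κ j
    · rw [ih θ]
      · rfl
      · intro i hi
        by_cases hij : i = j
        · subst hij
          exact hκΘ _ hθj
        · exact hθ i (by simp [hij, hi])
    · simp [normalizedWeight, hθj]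

/-- If the groups are orthogonal and the determinant of the information block of each group is the
product of a function of the other groups and of the square of `w_j(θ_j)`, then the reference prior
is `∏ j, w_j(θ_j)`, for every order of the groups. -/
theorem isReferencePrior_of_orthogonal [Fintype J] {X : Type*} {𝒳 : Finset X}
    {f : X → (∀ j, D j → ℝ) → ℝ} {Θ : ∀ j, Set (D j → ℝ)} {w : ∀ j, (D j → ℝ) → ℝ}
    {q : J → (∀ j, D j → ℝ) → ℝ} (hreg : IsRegularModel 𝒳 f Θ)
    (horth : ∀ θ, (∀ j, θ j ∈ Θ j) → ∀ a b, a.1 ≠ b.1 → fisherInfo 𝒳 f θ a b = 0)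
    (hdet : ∀ θ, (∀ j, θ j ∈ Θ j) → ∀ j,
      Real.log ((fisherInfo 𝒳 f θ).submatrix (Sigma.mk j) (Sigma.mk j)).det
        = q j θ + 2 * Real.log (w j (θ j)))
    (hw : ∀ j, ∀ t ∈ Θ j, 0 < w j t) (hwc : ∀ j, ContinuousOn (w j) (Θ j))
    (hq : ∀ θ, (∀ j, θ j ∈ Θ j) → ∀ j, ∀ t ∈ Θ j, q j (Function.update θ j t) = q j θ)
    (hqc : ∀ j, ContinuousOn (q j) {θ | ∀ j, θ j ∈ Θ j})
    (hvol : ∀ j, volume (Θ j) ≠ 0)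
    (hex : ∃ κ : ℕ → ∀ j, Set (D j → ℝ), IsCompactExhaustion Θ κ)
    {L : List J} (hL : L.Nodup) (hmem : ∀ j, j ∈ L) {π : (∀ j, D j → ℝ) → ℝ}
    (hπ : ∀ θ, (∀ j, θ j ∈ Θ j) → π θ = ∏ j, w j (θ j)) :
    IsReferencePrior 𝒳 f Θ L π where
  regular := hreg
  pos θ hθ := by
    rw [hπ θ hθ]
    exact Finset.prod_pos fun j _ => hw j _ (hθ j)
  exists_exhaustion := hex
  tendsto κ hκ θ θ₀ hθ hθ₀ := by
    have hmono : ∀ j, Monotone fun n => κ n j := fun j =>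
      monotone_nat_of_le_succ fun n => hκ.nested n j
    have hsub : ∀ n j, κ n j ⊆ Θ j := fun n j => by
      rw [← hκ.exhausts j]
      exact Set.subset_iUnion (fun n => κ n j) n
    have hev : ∀ η : ∀ j, D j → ℝ, (∀ j, η j ∈ Θ j) → ∀ᶠ n in atTop, ∀ j, η j ∈ κ n j := by
      intro η hη
      refine eventually_all.2 fun j => ?_
      have := hη j
      rw [← hκ.exhausts j, Set.mem_iUnion] at this
      obtain ⟨n, hn⟩ := this
      filter_upwards [eventually_ge_atTop n] with k hk using hmono j hk hn
    have hevol : ∀ᶠ n in atTop, ∀ j, volume (κ n j) ≠ 0 := by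
      refine eventually_all.2 fun j => ?_
      obtain ⟨n, hn⟩ : ∃ n, volume (κ n j) ≠ 0 := by
        by_contra! h
        exact hvol j (by rw [← hκ.exhausts j]; exact measure_iUnion_null h)
      filter_upwards [eventually_ge_atTop n] with k hk h
      exact hn (measure_mono_null (hmono j hk) h)
    refine tendsto_const_nhds.congr' ?_
    filter_upwards [hev θ hθ, hev θ₀ hθ₀, hevol] with n h1 h2 h3
    have hL' : L.toFinset = Finset.univ := by
      ext j
      simp [hmem j]
    have hdens : ∀ η : ∀ j, D j → ℝ, (∀ j, η j ∈ Θ j) → (∀ j, η j ∈ κ n j) →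
        refDensity (fisherInfo 𝒳 f) (κ n) L η = π η / ∏ j, ∫ s in κ n j, w j s := by
      intro η hη hηκ
      rw [refDensity_eq_prod (Θ := Θ) (w := w) (q := q) _ hw hwc hq hqc (hκ.compact n) (hsub n) h3
        L hL η fun j _ => hη j, hL', hπ η hη, ← Finset.prod_div_distrib]
      · refine Finset.prod_congr rfl fun j _ => ?_
        rw [normalizedWeight, Set.indicator_of_mem (hηκ j)]
      · intro θ hθ j rest
        rw [refBlock_eq_submatrix (horth θ hθ)
          ((Matrix.isUnit_iff_isUnit_det _).1 (hreg.posDef θ hθ).isUnit), hdet θ hθ]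
    have hZ : ∏ j, ∫ s in κ n j, w j s ≠ 0 := by
      exact Finset.prod_ne_zero_iff.2 fun j _ =>
        (setIntegral_pos_of_isCompact (hκ.compact n j) (h3 j) ((hwc j).mono (hsub n j))
          fun t ht => hw j t (hsub n j ht)).ne'
    rw [hdens θ hθ h1, hdens θ₀ hθ₀ h2, div_div_div_cancel_right₀ hZ]

end Reference

/-! ### Moments of the multinomial distribution -/

section Multinomial

variable {ι : Type*} [Fintype ι]

theorem sum_multinomialProb [DecidableEq ι] (p : ι → ℝ) (N : ℕ) :
    ∑ n ∈ Finset.piAntidiag Finset.univ N, multinomialProb p n = (∑ i, p i) ^ N :=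
  (Finset.sum_pow_eq_sum_piAntidiag _ _ _).symm

theorem multinomialProb_mul (p u : ι → ℝ) (n : ι → ℕ) :
    multinomialProb (fun i => p i * u i) n = multinomialProb p n * ∏ i, u i ^ n i := by
  simp only [multinomialProb, mul_pow, Finset.prod_mul_distrib, mul_assoc]

theorem hasDerivAt_prod_one_add_pow [DecidableEq ι] (a : ι → ℝ) (n : ι → ℕ) :
    HasDerivAt (fun t : ℝ => ∏ i, (1 + t * a i) ^ n i) (∑ i, n i * a i) 0 := by
  have h : ∀ i ∈ (Finset.univ : Finset ι),
      HasDerivAt (fun t : ℝ => (1 + t * a i) ^ n i) (n i * a i) 0 := by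
    intro i _
    have := (((hasDerivAt_id (0 : ℝ)).mul_const (a i)).const_add 1).fun_pow (n i)
    simpa using this
  have := HasDerivAt.fun_finsetProd h
  simpa using this

theorem hasDerivAt_multinomialProb [DecidableEq ι] (p a : ι → ℝ) (n : ι → ℕ) :
    HasDerivAt (fun t : ℝ => multinomialProb (fun i => p i * (1 + t * a i)) n)
      (multinomialProb p n * ∑ i, n i * a i) 0 := by
  simp only [multinomialProb_mul]
  exact (hasDerivAt_prod_one_add_pow a n).const_mul _

theorem hasDerivAt_sum_mul_one_add (p a : ι → ℝ) :
    HasDerivAt (fun t : ℝ => ∑ i, p i * (1 + t * a i)) (∑ i, p i * a i) 0 := by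
  refine HasDerivAt.fun_sum fun i _ => ?_
  have := (((hasDerivAt_id (0 : ℝ)).mul_const (a i)).const_add 1).const_mul (p i)
  simpa using this

/-- The first moments, obtained by differentiating the multinomial theorem along
`t ↦ p (1 + t a)`. -/
theorem sum_multinomialProb_mul_sum [DecidableEq ι] (p a : ι → ℝ) (N : ℕ) :
    ∑ n ∈ Finset.piAntidiag Finset.univ N, multinomialProb p n * ∑ i, n i * a i
      = N * (∑ i, p i) ^ (N - 1) * ∑ i, p i * a i := by
  have h1 : HasDerivAt (fun t : ℝ => ∑ n ∈ Finset.piAntidiag Finset.univ N,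
      multinomialProb (fun i => p i * (1 + t * a i)) n)
      (∑ n ∈ Finset.piAntidiag Finset.univ N, multinomialProb p n * ∑ i, n i * a i) 0 :=
    HasDerivAt.fun_sum fun n _ => hasDerivAt_multinomialProb p a n
  have h2 := (hasDerivAt_sum_mul_one_add p a).fun_pow N
  simp only [sum_multinomialProb] at h1
  simpa using h1.unique h2

/-- The second moments, obtained by differentiating the first ones along `t ↦ p (1 + t b)`. -/
theorem sum_multinomialProb_mul_sum_mul_sum [DecidableEq ι] {p a : ι → ℝ} (hp : ∑ i, p i = 1)
    (ha : ∑ i, p i * a i = 0) (b : ι → ℝ) (N : ℕ) :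
    ∑ n ∈ Finset.piAntidiag Finset.univ N,
        multinomialProb p n * (∑ i, n i * a i) * (∑ i, n i * b i)
      = N * ∑ i, p i * a i * b i := by
  have h1 : HasDerivAt (fun t : ℝ => ∑ n ∈ Finset.piAntidiag Finset.univ N,
      multinomialProb (fun i => p i * (1 + t * b i)) n * ∑ i, n i * a i)
      (∑ n ∈ Finset.piAntidiag Finset.univ N,
        multinomialProb p n * (∑ i, n i * b i) * ∑ i, n i * a i) 0 :=
    HasDerivAt.fun_sum fun n _ => (hasDerivAt_multinomialProb p b n).mul_const _
  have h2 := ((hasDerivAt_sum_mul_one_add p b).fun_pow (N - 1)).const_mul (N : ℝ)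
  have h3 : HasDerivAt (fun t : ℝ => ∑ i, p i * (1 + t * b i) * a i)
      (∑ i, p i * a i * b i) 0 := by
    have := hasDerivAt_sum_mul_one_add (fun i => p i * a i) b
    refine this.congr_of_eventuallyEq (Eventually.of_forall fun t => ?_)
    exact Finset.sum_congr rfl fun i _ => by ring
  simp only [sum_multinomialProb_mul_sum] at h1
  have h4 := h1.unique (h2.mul h3)
  simp only [zero_mul, add_zero, mul_one, hp, one_pow, ha, mul_zero, zero_add] at h4
  rw [← h4]
  exact Finset.sum_congr rfl fun n _ => by ring

end Multinomial

/-! ### Open simplices -/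

section Simplex

variable {ι : Type*} [Fintype ι]

/-- The open simplex in terms of the free coordinates. -/
def openSimplex (ι : Type*) [Fintype ι] : Set (ι → ℝ) :=
  {t | (∀ r, 0 < t r) ∧ ∑ r, t r < 1}

theorem isOpen_openSimplex : IsOpen (openSimplex ι) := by
  have h1 : IsOpen {t : ι → ℝ | ∀ r, 0 < t r} := by
    simp only [Set.ofPred_forall]
    exact isOpen_iInter_of_finite fun r => isOpen_lt continuous_const (continuous_apply r)
  exact h1.inter (isOpen_lt (continuous_finsetSum _ fun r _ => continuous_apply r) continuous_const)

theorem openSimplex_nonempty : (openSimplex ι).Nonempty := by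
  refine ⟨fun _ => 1 / (Fintype.card ι + 1), fun r => by positivity, ?_⟩
  rw [Finset.sum_const, Finset.card_univ, nsmul_eq_mul, mul_one_div, div_lt_one (by positivity)]
  linarith

/-- The closed simplices that are kept away from the faces by `1 / (n + 1)`. -/
def innerSimplex (ι : Type*) [Fintype ι] (n : ℕ) : Set (ι → ℝ) :=
  {t | (∀ r, 1 / ((n : ℝ) + 1) ≤ t r) ∧ ∑ r, t r ≤ 1 - 1 / ((n : ℝ) + 1)}

theorem isCompact_innerSimplex (n : ℕ) : IsCompact (innerSimplex ι n) := by
  have hc : IsClosed (innerSimplex ι n) := by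
    have h1 : IsClosed {t : ι → ℝ | ∀ r, 1 / ((n : ℝ) + 1) ≤ t r} := by
      simp only [Set.ofPred_forall]
      exact isClosed_iInter fun r => isClosed_le continuous_const (continuous_apply r)
    exact h1.inter
      (isClosed_le (continuous_finsetSum _ fun r _ => continuous_apply r) continuous_const)
  refine (isCompact_Icc (a := (0 : ι → ℝ)) (b := 1)).of_isClosed_subset hc fun t ht => ?_
  have hn : 0 < 1 / ((n : ℝ) + 1) := by positivity
  have h0 : ∀ r, 0 ≤ t r := fun r => hn.le.trans (ht.1 r)
  refine ⟨h0, fun r => ?_⟩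
  calc t r ≤ ∑ r, t r := Finset.single_le_sum (fun r _ => h0 r) (Finset.mem_univ r)
    _ ≤ 1 := by linarith [ht.2]

theorem innerSimplex_subset_succ (n : ℕ) : innerSimplex ι n ⊆ innerSimplex ι (n + 1) := by
  have h : 1 / (((n + 1 : ℕ) : ℝ) + 1) ≤ 1 / ((n : ℝ) + 1) :=
    one_div_le_one_div_of_le (by positivity) (by push_cast; linarith)
  exact fun t ht => ⟨fun r => h.trans (ht.1 r), by linarith [ht.2]⟩

theorem iUnion_innerSimplex : ⋃ n, innerSimplex ι n = openSimplex ι := by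
  ext t
  rw [Set.mem_iUnion]
  constructor
  · rintro ⟨n, hn⟩
    have : 0 < 1 / ((n : ℝ) + 1) := by positivity
    exact ⟨fun r => this.trans_le (hn.1 r), by linarith [hn.2]⟩
  · intro ht
    have hlim := tendsto_one_div_add_atTop_nhds_zero_nat (𝕜 := ℝ)
    have h1 : ∀ᶠ n : ℕ in atTop, ∀ r, 1 / ((n : ℝ) + 1) ≤ t r :=
      eventually_all.2 fun r => (hlim.eventually_lt_const (ht.1 r)).mono fun n hn => hn.le
    have h2 : ∀ᶠ n : ℕ in atTop, 1 / ((n : ℝ) + 1) ≤ 1 - ∑ r, t r :=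
      (hlim.eventually_lt_const (by linarith [ht.2])).mono fun n hn => hn.le
    obtain ⟨n, hn1, hn2⟩ := (h1.and h2).exists
    exact ⟨n, hn1, by linarith⟩

theorem volume_openSimplex_ne_zero : volume (openSimplex ι) ≠ 0 :=
  (isOpen_openSimplex.measure_pos volume openSimplex_nonempty).ne'

variable [DecidableEq ι]

/-- The determinant of the information matrix of a table of probabilities. -/
theorem det_diagonal_add_const {t : ι → ℝ} (ht : ∀ r, t r ≠ 0) {t₀ : ℝ} (ht₀ : t₀ ≠ 0)
    (hsum : t₀ + ∑ r, t r = 1) :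
    (Matrix.of fun r r' => (if r = r' then (t r)⁻¹ else 0) + t₀⁻¹ : Matrix ι ι ℝ).det
      = t₀⁻¹ * ∏ r, (t r)⁻¹ := by
  have h : (Matrix.of fun r r' => (if r = r' then (t r)⁻¹ else 0) + t₀⁻¹ : Matrix ι ι ℝ)
      = Matrix.diagonal (fun r => (t r)⁻¹) *
        (1 + Matrix.replicateCol Unit (fun r => t r * t₀⁻¹) *
          Matrix.replicateRow Unit (fun _ => (1 : ℝ))) := by
    ext r r'
    rw [Matrix.diagonal_mul, Matrix.add_apply, Matrix.mul_apply, Matrix.of_apply,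
      Matrix.one_apply, mul_add]
    simp only [Matrix.replicateCol_apply, Matrix.replicateRow_apply, Finset.univ_unique,
      Finset.sum_singleton, mul_one, mul_ite, mul_zero]
    rw [← mul_assoc, inv_mul_cancel₀ (ht r), one_mul]
  rw [h, Matrix.det_mul, Matrix.det_diagonal, Matrix.det_one_add_replicateCol_mul_replicateRow,
    mul_comm]
  congr 1
  simp only [dotProduct, one_mul]
  rw [← Finset.sum_mul, eq_sub_of_add_eq' hsum]
  field_simp
  ring

end Simplex

section Graphical

variable {V : Type*} [DecidableEq V] {I : V → Type*}

/-! ### Cells and marginal tables -/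

/-- The cell `i` with its `R`-coordinates replaced by `x`. -/
def glue (R : Finset V) (i : ∀ γ, I γ) (x : Cell I R) : ∀ γ, I γ :=
  fun γ => if h : γ ∈ R then x ⟨γ, h⟩ else i γ

theorem restrict_glue (R : Finset V) (i : ∀ γ, I γ) (x : Cell I R) :
    R.restrict (glue R i x) = x := by
  ext γ
  simp [glue]

theorem restrict_glue_of_disjoint {S R : Finset V} (h : Disjoint S R) (i : ∀ γ, I γ)
    (x : Cell I R) : S.restrict (glue R i x) = S.restrict i := by
  ext γ
  simp [glue, Finset.disjoint_left.1 h γ.2]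

theorem glue_glue_restrict (R : Finset V) (i : ∀ γ, I γ) (x : Cell I R) :
    glue R (glue R i x) (R.restrict i) = i := by
  ext γ
  by_cases h : γ ∈ R <;> simp [glue, h]

theorem restrict_eq_restrict_iff {V : Type*} {I : V → Type*} {S : Finset V} {i j : ∀ γ, I γ} :
    S.restrict i = S.restrict j ↔ ∀ γ ∈ S, i γ = j γ := by
  simp [funext_iff]

theorem dependsOn_comp_update {f : (∀ γ, I γ) → ℝ} {D : Finset V} (hf : DependsOn f (D : Set V))
    (α : V) (a : I α) :
    DependsOn (fun i => f (Function.update i α a)) ((D.erase α : Finset V) : Set V) := by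
  intro i j hij
  refine hf fun γ hγ => ?_
  by_cases h : γ = α
  · subst h
    simp
  · rw [Function.update_of_ne h, Function.update_of_ne h]
    exact hij γ (by simpa [h] using hγ)

variable [Fintype V] [∀ γ, Fintype (I γ)] [∀ γ, DecidableEq (I γ)]

/-- Resampling the coordinates in `R`: `(i, x) ↦ (glue R i x, i_R)` is an involution. -/
theorem sum_sum_glue (R : Finset V) (F : (∀ γ, I γ) → ℝ) :
    ∑ i, ∑ x, F (glue R i x) = Fintype.card (Cell I R) * ∑ i, F i := by
  have h1 : ∑ i, ∑ x, F (glue R i x) = ∑ z : (∀ γ, I γ) × Cell I R, F (glue R z.1 z.2) :=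
    (Fintype.sum_prod_type' fun i x => F (glue R i x)).symm
  have h2 : ∑ z : (∀ γ, I γ) × Cell I R, F (glue R z.1 z.2)
      = ∑ z : (∀ γ, I γ) × Cell I R, F z.1 := by
    have hinv : Function.Involutive
        fun z : (∀ γ, I γ) × Cell I R => (glue R z.1 z.2, R.restrict z.1) := by
      rintro ⟨i, x⟩
      simp only [Prod.mk.injEq]
      exact ⟨glue_glue_restrict R i x, restrict_glue R i x⟩
    exact Equiv.sum_comp hinv.toPerm fun z => F z.1
  rw [h1, h2, Fintype.sum_prod_type, Finset.mul_sum]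
  exact Finset.sum_congr rfl fun i _ => by simp

theorem marginal_pos {p : (∀ γ, I γ) → ℝ} (hp : ∀ i, 0 < p i) (i₀ : ∀ γ, I γ) (S : Finset V)
    (s : Cell I S) : 0 < marginal p S s := by
  refine Finset.sum_pos (fun i _ => hp i) ⟨glue S i₀ s, ?_⟩
  simp [restrict_glue]

theorem sum_mul_restrict (p : (∀ γ, I γ) → ℝ) (S : Finset V) (h : Cell I S → ℝ) :
    ∑ i, p i * h (S.restrict i) = ∑ s, marginal p S s * h s := by
  rw [← Finset.sum_fiberwise Finset.univ S.restrict]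
  refine Finset.sum_congr rfl fun s _ => ?_
  rw [marginal, Finset.sum_mul]
  refine Finset.sum_congr rfl fun i hi => ?_
  rw [(Finset.mem_filter.1 hi).2]

theorem conditional_mul_marginal {p : (∀ γ, I γ) → ℝ} (hp : ∀ i, 0 < p i) (i₀ : ∀ γ, I γ)
    (R S : Finset V) (s : Cell I S) (r : Cell I R) :
    conditional p R S s r * marginal p S s
      = ∑ i with R.restrict i = r ∧ S.restrict i = s, p i :=
  div_mul_cancel₀ _ (marginal_pos hp i₀ S s).ne'

/-- The tower property. -/
theorem sum_mul_restrict_restrict {p : (∀ γ, I γ) → ℝ} (hp : ∀ i, 0 < p i) (i₀ : ∀ γ, I γ)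
    (R S : Finset V) (F : Cell I S → Cell I R → ℝ) :
    ∑ i, p i * F (S.restrict i) (R.restrict i)
      = ∑ i, p i * ∑ r, conditional p R S (S.restrict i) r * F (S.restrict i) r := by
  rw [sum_mul_restrict p S fun s => ∑ r, conditional p R S s r * F s r,
    ← Finset.sum_fiberwise Finset.univ S.restrict]
  refine Finset.sum_congr rfl fun s _ => ?_
  rw [← Finset.sum_fiberwise _ R.restrict, Finset.mul_sum]
  refine Finset.sum_congr rfl fun r _ => ?_
  rw [← mul_assoc, mul_comm (marginal p S s), conditional_mul_marginal hp i₀, Finset.sum_mul,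
    Finset.filter_filter]
  refine Finset.sum_congr (by simp only [and_comm]) fun i hi => ?_
  obtain ⟨h1, h2⟩ := (Finset.mem_filter.1 hi).2
  rw [h1, h2]

theorem sum_conditional {p : (∀ γ, I γ) → ℝ} (hp : ∀ i, 0 < p i) (i₀ : ∀ γ, I γ)
    (R S : Finset V) (s : Cell I S) : ∑ r, conditional p R S s r = 1 := by
  simp only [conditional]
  rw [← Finset.sum_div, div_eq_one_iff_eq (marginal_pos hp i₀ S s).ne', marginal,
    ← Finset.sum_fiberwise _ R.restrict]
  refine Finset.sum_congr rfl fun r _ => ?_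
  rw [Finset.filter_filter]
  simp only [and_comm]

theorem conditional_pos {p : (∀ γ, I γ) → ℝ} (hp : ∀ i, 0 < p i) (i₀ : ∀ γ, I γ)
    {R S : Finset V} (h : Disjoint S R) (s : Cell I S) (r : Cell I R) :
    0 < conditional p R S s r := by
  refine div_pos (Finset.sum_pos (fun i _ => hp i) ⟨glue R (glue S i₀ s) r, ?_⟩)
    (marginal_pos hp i₀ S s)
  simp [restrict_glue, restrict_glue_of_disjoint h]

theorem marginal_compl_singleton (p : (∀ γ, I γ) → ℝ) (γ : V) (i : ∀ γ, I γ) :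
    marginal p (Finset.univ \ {γ}) (Finset.restrict _ i) = ∑ x, p (Function.update i γ x) := by
  rw [marginal]
  symm
  refine Finset.sum_bij (fun x _ => Function.update i γ x) ?_ ?_ ?_ ?_
  · intro x _
    simp only [Finset.mem_filter, Finset.mem_univ, true_and, restrict_eq_restrict_iff]
    intro δ hδ
    rw [Function.update_of_ne (by simpa using hδ)]
  · intro x _ y _ h
    exact Function.update_injective i γ h
  · intro j hj
    simp only [Finset.mem_filter, Finset.mem_univ, true_and, restrict_eq_restrict_iff] at hj
    refine ⟨j γ, Finset.mem_univ _, ?_⟩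
    rw [Function.update_eq_iff]
    exact ⟨rfl, fun δ hδ => (hj δ (by simpa using hδ)).symm⟩
  · intro x _
    rfl

theorem marginal_compl_pair (p : (∀ γ, I γ) → ℝ) {γ δ : V} (hγδ : γ ≠ δ) (i : ∀ γ, I γ) :
    marginal p (Finset.univ \ {γ, δ}) (Finset.restrict _ i)
      = ∑ x, ∑ y, p (Function.update (Function.update i γ x) δ y) := by
  rw [marginal, ← Fintype.sum_prod_type' fun x y =>
    p (Function.update (Function.update i γ x) δ y)]
  symm
  refine Finset.sum_bij (fun z _ => Function.update (Function.update i γ z.1) δ z.2) ?_ ?_ ?_ ?_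
  · intro x _
    simp only [Finset.mem_filter, Finset.mem_univ, true_and, restrict_eq_restrict_iff]
    intro ε hε
    simp only [Finset.mem_sdiff, Finset.mem_univ, Finset.mem_insert, Finset.mem_singleton,
      true_and, not_or] at hε
    rw [Function.update_of_ne hε.2, Function.update_of_ne hε.1]
  · rintro ⟨x, y⟩ _ ⟨x', y'⟩ _ h
    have h1 := congrFun h γ
    have h2 := congrFun h δ
    simp only [Function.update_self, Function.update_of_ne hγδ] at h1 h2
    rw [h1, h2]
  · intro j hj
    simp only [Finset.mem_filter, Finset.mem_univ, true_and, restrict_eq_restrict_iff] at hj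
    refine ⟨(j γ, j δ), Finset.mem_univ _, ?_⟩
    simp only
    rw [Function.update_eq_iff]
    refine ⟨rfl, fun ε hε => ?_⟩
    by_cases h : ε = γ
    · subst h
      simp
    · rw [Function.update_of_ne h]
      exact (hj ε (by simp [h, hε])).symm
  · intro x _
    rfl

/-! ### Markov tables and interactions -/

theorem mem_markovModel_of_factorization {G : SimpleGraph V} {Λ : Type*} [Fintype Λ]
    {C : Λ → Finset V} (hC : ∀ l, G.IsClique (C l : Set V)) {φ : Λ → (∀ γ, I γ) → ℝ}
    (hφ : ∀ l, DependsOn (φ l) (C l : Set V)) (hpos : ∀ l i, 0 < φ l i)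
    (hsum : ∑ i, ∏ l, φ l i = 1) : (fun i => ∏ l, φ l i) ∈ markovModel (I := I) G := by
  refine ⟨fun i => Finset.prod_pos fun l _ => hpos l i, hsum, fun γ δ hγδ hadj i => ?_⟩
  -- `a` collects the factors that do not involve `γ`, and `b` those that do; the latter cannot
  -- involve `δ`.
  set a : (∀ γ, I γ) → ℝ := fun i => ∏ l with γ ∉ C l, φ l i with ha
  set b : (∀ γ, I γ) → ℝ := fun i => ∏ l with ¬ γ ∉ C l, φ l i with hb
  have hab : ∀ i, ∏ l, φ l i = a i * b i := fun i =>
    (Finset.prod_filter_mul_prod_filter_not Finset.univ (fun l => γ ∉ C l) fun l => φ l i).symm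
  have hupd : ∀ (l : Λ) (ε : V), ε ∉ C l → ∀ (i : ∀ γ, I γ) (x : I ε),
      φ l (Function.update i ε x) = φ l i := by
    intro l ε hε i x
    refine hφ l fun ζ hζ => ?_
    rw [Function.update_of_ne]
    rintro rfl
    exact hε hζ
  have haγ : ∀ i x, a (Function.update i γ x) = a i := fun i x =>
    Finset.prod_congr rfl fun l hl => hupd l γ (by simpa using hl) i x
  have hbδ : ∀ i y, b (Function.update i δ y) = b i := by
    refine fun i y => Finset.prod_congr rfl fun l hl => hupd l δ (fun hδ => ?_) i y
    exact hadj (hC l (by simpa using hl) hδ hγδ)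
  rw [marginal_compl_singleton, marginal_compl_singleton, marginal_compl_pair _ hγδ]
  simp only [hab, haγ, hbδ]
  have h1 : ∀ x y, a (Function.update (Function.update i γ x) δ y) = a (Function.update i δ y) := by
    intro x y
    rw [Function.update_comm hγδ, haγ]
  simp only [h1]
  rw [← Finset.mul_sum, ← Finset.sum_mul]
  simp only [← Finset.sum_mul, ← Finset.mul_sum]
  ring

/-- The mixed differences of `f` in two coordinates that are not adjacent vanish. -/
def NoInteraction (G : SimpleGraph V) (f : (∀ γ, I γ) → ℝ) : Prop :=
  ∀ γ δ, γ ≠ δ → ¬ G.Adj γ δ → ∀ (i : ∀ γ, I γ) (x : I γ) (y : I δ),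
    f i + f (Function.update (Function.update i γ x) δ y)
      = f (Function.update i γ x) + f (Function.update i δ y)

theorem noInteraction_log {G : SimpleGraph V} {p : (∀ γ, I γ) → ℝ} (hp : p ∈ markovModel G) :
    NoInteraction G fun i => Real.log (p i) := by
  obtain ⟨hpos, -, hM⟩ := hp
  intro γ δ hγδ hadj i x y
  have hpos' : ∀ S : Finset V, ∀ j : ∀ γ, I γ, 0 < marginal p S (S.restrict j) := fun S j =>
    marginal_pos hpos j S _
  -- `log p` is a sum of functions each of which misses one of the two coordinates.
  set A : (∀ γ, I γ) → ℝ := fun j => Real.log (∑ x, p (Function.update j γ x)) with hA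
  set B : (∀ γ, I γ) → ℝ := fun j => Real.log (∑ x, p (Function.update j δ x)) with hB
  set C : (∀ γ, I γ) → ℝ := fun j =>
    Real.log (∑ x, ∑ y, p (Function.update (Function.update j γ x) δ y)) with hC
  have key : ∀ j, Real.log (p j) = A j + B j - C j := by
    intro j
    have h := congrArg Real.log (hM γ δ hγδ hadj j)
    rw [Real.log_mul (hpos j).ne' (hpos' _ j).ne',
      Real.log_mul (hpos' _ j).ne' (hpos' _ j).ne', marginal_compl_pair _ hγδ,
      marginal_compl_singleton, marginal_compl_singleton] at h
    simp only [hA, hB, hC]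
    linarith
  have hAγ : ∀ j x, A (Function.update j γ x) = A j := fun j x => by
    simp only [hA, Function.update_idem]
  have hBδ : ∀ j x, B (Function.update j δ x) = B j := fun j x => by
    simp only [hB, Function.update_idem]
  have hCγ : ∀ j x, C (Function.update j γ x) = C j := fun j x => by
    simp only [hC, Function.update_idem]
  have hCδ : ∀ j x, C (Function.update j δ x) = C j := fun j x => by
    simp only [hC, Function.update_comm hγδ, Function.update_idem]
  have hAB : A (Function.update (Function.update i γ x) δ y) = A (Function.update i δ y) := by
    rw [Function.update_comm hγδ, hAγ]
  simp only
  rw [key i, key (Function.update (Function.update i γ x) δ y), key (Function.update i γ x),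
    key (Function.update i δ y), hAB, hBδ, hBδ, hAγ, hCδ, hCγ, hCδ]
  ring

theorem NoInteraction.comp_update {G : SimpleGraph V} {f : (∀ γ, I γ) → ℝ}
    (hf : NoInteraction G f) (α : V) (a : I α) :
    NoInteraction G fun i => f (Function.update i α a) := by
  intro γ δ hγδ hadj i x y
  simp only
  by_cases h1 : α = γ
  · subst h1
    rw [Function.update_comm hγδ]
    simp only [Function.update_idem]
  by_cases h2 : α = δ
  · subst h2
    simp only [Function.update_idem]
    ring
  have := hf γ δ hγδ hadj (Function.update i α a) x y
  rw [Function.update_comm (Ne.symm h1), Function.update_comm (Ne.symm h2),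
    Function.update_comm (Ne.symm h2), Function.update_comm (Ne.symm h1)]
  exact this

/-- A linear functional that annihilates the functions of complete sets of variables annihilates
the functions without interactions between vertices that are not adjacent.  If `f` is a function
of the variables in `D` and `γ`, `δ` in `D` are not adjacent, then fixing one or both of these
variables writes `f` in terms of functions of fewer variables. -/
theorem sum_mul_eq_zero_of_noInteraction {G : SimpleGraph V} (i₀ : ∀ γ, I γ)
    {d : (∀ γ, I γ) → ℝ}
    (hd : ∀ D : Finset V, G.IsClique (D : Set V) → ∀ f : (∀ γ, I γ) → ℝ,
      DependsOn f (D : Set V) → ∑ i, d i * f i = 0)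
    {f : (∀ γ, I γ) → ℝ} (hf : NoInteraction G f) : ∑ i, d i * f i = 0 := by
  suffices H : ∀ n (D : Finset V), D.card = n → ∀ f : (∀ γ, I γ) → ℝ, NoInteraction G f →
      DependsOn f (D : Set V) → ∑ i, d i * f i = 0 by
    refine H _ Finset.univ rfl f hf fun i j hij => ?_
    rw [funext fun γ => hij γ (by simp)]
  intro n
  induction n using Nat.strong_induction_on with
  | _ n ih =>
    intro D hD f hf hfD
    by_cases hcl : G.IsClique (D : Set V)
    · exact hd D hcl f hfD
    · simp only [SimpleGraph.IsClique, Set.Pairwise, not_forall] at hcl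
      obtain ⟨γ, hγ, δ, hδ, hγδ, hadj⟩ := hcl
      have hγ' : (D.erase γ).card < n := hD ▸ Finset.card_erase_lt_of_mem hγ
      have hδ' : (D.erase δ).card < n := hD ▸ Finset.card_erase_lt_of_mem hδ
      have h1 := ih _ hγ' _ rfl _ (hf.comp_update γ (i₀ γ)) (dependsOn_comp_update hfD γ (i₀ γ))
      have h2 := ih _ hδ' _ rfl _ (hf.comp_update δ (i₀ δ)) (dependsOn_comp_update hfD δ (i₀ δ))
      have h3 := ih _ ((Finset.card_le_card (Finset.erase_subset _ _)).trans_lt hδ') _ rfl _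
        ((hf.comp_update δ (i₀ δ)).comp_update γ (i₀ γ))
        (dependsOn_comp_update (dependsOn_comp_update hfD δ (i₀ δ)) γ (i₀ γ))
      have h4 : ∀ i, d i * f i = d i * f (Function.update i γ (i₀ γ))
          + d i * f (Function.update i δ (i₀ δ))
          - d i * f (Function.update (Function.update i γ (i₀ γ)) δ (i₀ δ)) := by
        intro i
        have := hf γ δ hγδ hadj i (i₀ γ) (i₀ δ)
        rw [eq_sub_of_add_eq this]
        ring
      rw [Finset.sum_congr rfl fun i _ => h4 i, Finset.sum_sub_distrib, Finset.sum_add_distrib,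
        h1, h2, h3]
      ring

/-- A Markov table is determined by its marginals on the complete sets: the symmetrised
Kullback-Leibler divergence `∑ (p - p') (log p - log p')` vanishes, since `log p` and `log p'` have
no interactions between vertices that are not adjacent. -/
theorem markovModel_ext {G : SimpleGraph V} {p p' : (∀ γ, I γ) → ℝ}
    (hp : p ∈ markovModel G) (hp' : p' ∈ markovModel G)
    (h : ∀ D : Finset V, G.IsClique (D : Set V) → ∀ f : (∀ γ, I γ) → ℝ,
      DependsOn f (D : Set V) → ∑ i, p i * f i = ∑ i, p' i * f i) : p = p' := by
  ext i₀
  have hd : ∀ D : Finset V, G.IsClique (D : Set V) → ∀ f : (∀ γ, I γ) → ℝ,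
      DependsOn f (D : Set V) → ∑ i, (p i - p' i) * f i = 0 := by
    intro D hD f hf
    simp only [sub_mul, Finset.sum_sub_distrib, h D hD f hf, sub_self]
  have h1 := sum_mul_eq_zero_of_noInteraction i₀ hd (noInteraction_log hp)
  have h2 := sum_mul_eq_zero_of_noInteraction i₀ hd (noInteraction_log hp')
  have h3 : ∑ i, (p i - p' i) * (Real.log (p i) - Real.log (p' i)) = 0 := by
    simp only [mul_sub, Finset.sum_sub_distrib, h1, h2, sub_self]
  have h4 : ∀ i, 0 ≤ (p i - p' i) * (Real.log (p i) - Real.log (p' i)) := by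
    intro i
    rcases le_total (p i) (p' i) with hle | hle
    · exact mul_nonneg_of_nonpos_of_nonpos (sub_nonpos.2 hle)
        (sub_nonpos.2 (Real.log_le_log (hp.1 i) hle))
    · exact mul_nonneg (sub_nonneg.2 hle) (sub_nonneg.2 (Real.log_le_log (hp'.1 i) hle))
  have h5 := (Finset.sum_eq_zero_iff_of_nonneg fun i _ => h4 i).1 h3 i₀ (Finset.mem_univ _)
  rcases mul_eq_zero.1 h5 with h6 | h6
  · exact sub_eq_zero.1 h6
  · exact Real.log_injOn_pos (hp.1 i₀) (hp'.1 i₀) (sub_eq_zero.1 h6)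

end Graphical

section Chain

variable {V : Type*} [Fintype V] [DecidableEq V] {I : V → Type*} [∀ γ, Fintype (I γ)]
  [∀ γ, DecidableEq (I γ)]

/-! ### Products of conditional tables along a perfect sequence -/

/-- The sets `S l ∪ R l` form a perfect sequence of complete sets of `G` that exhausts the complete
sets, with separators `S l` and residuals `R l`.  The sequence is ordered by `ord`, which need not
be injective: sets of the same order do not meet the residuals of each other. -/
structure IsPerfectSequence (G : SimpleGraph V) {Λ : Type*} (S R : Λ → Finset V) (ord : Λ → ℕ) :
    Prop where
  disjoint : ∀ l, Disjoint (S l) (R l)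
  disjoint_of_le : ∀ k l, k ≠ l → ord k ≤ ord l → Disjoint (S k ∪ R k) (R l)
  isClique : ∀ l, G.IsClique ((S l ∪ R l : Finset V) : Set V)
  separator_subset : ∀ l, S l = ∅ ∨ ∃ k, ord k < ord l ∧ S l ⊆ S k ∪ R k
  exists_subset : ∀ D : Finset V, G.IsClique (D : Set V) → ∃ l, D ⊆ S l ∪ R l

variable {G : SimpleGraph V} {Λ : Type*} [Fintype Λ] [DecidableEq Λ] {S R : Λ → Finset V}
  {ord : Λ → ℕ}

theorem IsPerfectSequence.exists_mem_residual (h : IsPerfectSequence G S R ord) (γ : V) :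
    ∃ l, γ ∈ R l := by
  suffices H : ∀ n l, ord l = n → γ ∈ S l ∪ R l → ∃ l, γ ∈ R l by
    obtain ⟨l, hl⟩ := h.exists_subset {γ} (by simp)
    exact H _ l rfl (hl (Finset.mem_singleton_self γ))
  intro n
  induction n using Nat.strong_induction_on with
  | _ n ih =>
    intro l hn hl
    rcases Finset.mem_union.1 hl with hS | hR
    · rcases h.separator_subset l with h0 | ⟨k, hk, hSk⟩
      · simp [h0] at hS
      · exact ih _ (hn ▸ hk) k rfl (hSk hS)
    · exact ⟨l, hR⟩

theorem IsPerfectSequence.prod_card (h : IsPerfectSequence G S R ord) :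
    ∏ l, Fintype.card (Cell I (R l)) = Fintype.card (∀ γ, I γ) := by
  have hdisj : ∀ k l, k ≠ l → Disjoint (R k) (R l) := by
    intro k l hkl
    rcases le_total (ord k) (ord l) with hle | hle
    · exact (h.disjoint_of_le k l hkl hle).mono_left Finset.subset_union_right
    · exact ((h.disjoint_of_le l k hkl.symm hle).mono_left Finset.subset_union_right).symm
  have huniv : (Finset.univ : Finset V) = Finset.univ.biUnion R := by
    ext γ
    simpa using h.exists_mem_residual γ
  rw [Fintype.card_pi, huniv, Finset.prod_biUnion fun k _ l _ hkl => hdisj k l hkl]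
  refine Finset.prod_congr rfl fun l _ => ?_
  rw [Fintype.card_pi]
  exact Finset.prod_coe_sort (R l) fun γ => Fintype.card (I γ)

/-- The table of joint probabilities that has the conditional tables `T l`. -/
def chainProd (T : ∀ l, Cell I (S l) → Cell I (R l) → ℝ) (i : ∀ γ, I γ) : ℝ :=
  ∏ l, T l ((S l).restrict i) ((R l).restrict i)

variable {T : ∀ l, Cell I (S l) → Cell I (R l) → ℝ}

/-- The residual of a set of maximal order among the remaining ones does not meet the other sets,
so it can be summed out. -/
theorem IsPerfectSequence.sum_chainProd (h : IsPerfectSequence G S R ord) (i₀ : ∀ γ, I γ)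
    (hT : ∀ l s, ∑ r, T l s r = 1) : ∑ i, chainProd T i = 1 := by
  have key : ∀ F : Finset Λ, ∑ i : ∀ γ, I γ, ∏ l ∈ F, ((Fintype.card (Cell I (R l)) : ℝ) *
      T l ((S l).restrict i) ((R l).restrict i)) = Fintype.card (∀ γ, I γ) := by
    intro F
    induction F using Finset.induction_on_max_value ord with
    | empty => simp
    | insert a F haF hmax ih =>
      rw [← ih]
      simp only [Finset.prod_insert haF, mul_assoc]
      rw [← Finset.mul_sum, ← sum_sum_glue]
      refine Finset.sum_congr rfl fun i _ => ?_
      have hF : ∀ x : Cell I (R a), ∏ l ∈ F, ((Fintype.card (Cell I (R l)) : ℝ) *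
          T l ((S l).restrict (glue (R a) i x)) ((R l).restrict (glue (R a) i x)))
          = ∏ l ∈ F, ((Fintype.card (Cell I (R l)) : ℝ) *
            T l ((S l).restrict i) ((R l).restrict i)) := by
        intro x
        refine Finset.prod_congr rfl fun l hl => ?_
        have hd := h.disjoint_of_le l a (fun e => haF (e ▸ hl)) (hmax l hl)
        rw [restrict_glue_of_disjoint (hd.mono_left Finset.subset_union_left),
          restrict_glue_of_disjoint (hd.mono_left Finset.subset_union_right)]
      simp only [hF, restrict_glue, restrict_glue_of_disjoint (h.disjoint a)]
      rw [← Finset.sum_mul, hT, one_mul]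
  have h1 := key Finset.univ
  simp only [Finset.prod_mul_distrib] at h1
  rw [← Finset.mul_sum, ← Nat.cast_prod, h.prod_card] at h1
  have : Nonempty (∀ γ, I γ) := ⟨i₀⟩
  exact mul_left_cancel₀ (Nat.cast_ne_zero.2 Fintype.card_ne_zero) (h1.trans (mul_one _).symm)

/-- Perturbing the conditional tables does not change the total mass. -/
theorem IsPerfectSequence.sum_chainProd_mul_prod (h : IsPerfectSequence G S R ord)
    (i₀ : ∀ γ, I γ) (hT : ∀ l s, ∑ r, T l s r = 1)
    {e : ∀ l, Cell I (S l) → Cell I (R l) → ℝ} (he : ∀ l s, ∑ r, T l s r * e l s r = 0) :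
    ∑ i, chainProd T i * ∏ l, (1 + e l ((S l).restrict i) ((R l).restrict i)) = 1 := by
  have := h.sum_chainProd i₀ (T := fun l s r => T l s r * (1 + e l s r)) fun l s => by
    simp only [mul_add, mul_one, Finset.sum_add_distrib, hT, he, add_zero]
  refine Eq.trans (Finset.sum_congr rfl fun i _ => ?_) this
  rw [chainProd, chainProd, ← Finset.prod_mul_distrib]

theorem IsPerfectSequence.sum_chainProd_mul_eq_zero (h : IsPerfectSequence G S R ord)
    (i₀ : ∀ γ, I γ) (hT : ∀ l s, ∑ r, T l s r = 1) {l : Λ} {e : Cell I (S l) → Cell I (R l) → ℝ}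
    (he : ∀ s, ∑ r, T l s r * e s r = 0) :
    ∑ i, chainProd T i * e ((S l).restrict i) ((R l).restrict i) = 0 := by
  set z : ∀ m, Cell I (S m) → Cell I (R m) → ℝ := fun _ _ _ => 0 with hz
  have h1 := h.sum_chainProd_mul_prod i₀ hT (e := Function.update z l e) fun k s => by
      by_cases hk : k = l
      · subst hk
        simp [he]
      · simp [hk, hz]
  have h2 : ∀ i : ∀ γ, I γ, ∏ k,
      (1 + Function.update z l e k ((S k).restrict i) ((R k).restrict i))
        = 1 + e ((S l).restrict i) ((R l).restrict i) := by
    intro i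
    rw [Fintype.prod_eq_single l fun k hk => by simp [hk, hz]]
    simp
  simp only [h2, mul_add, mul_one, Finset.sum_add_distrib, h.sum_chainProd i₀ hT] at h1
  linarith

/-- Scores that belong to different sets of the sequence are orthogonal. -/
theorem IsPerfectSequence.sum_chainProd_mul_mul_eq_zero (h : IsPerfectSequence G S R ord)
    (i₀ : ∀ γ, I γ) (hT : ∀ l s, ∑ r, T l s r = 1) {k l : Λ} (hkl : k ≠ l)
    {d : Cell I (S k) → Cell I (R k) → ℝ} {e : Cell I (S l) → Cell I (R l) → ℝ}
    (hd : ∀ s, ∑ r, T k s r * d s r = 0) (he : ∀ s, ∑ r, T l s r * e s r = 0) :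
    ∑ i, chainProd T i * (d ((S k).restrict i) ((R k).restrict i) *
      e ((S l).restrict i) ((R l).restrict i)) = 0 := by
  set z : ∀ m, Cell I (S m) → Cell I (R m) → ℝ := fun _ _ _ => 0 with hz
  have h1 := h.sum_chainProd_mul_prod i₀ hT
    (e := Function.update (Function.update z l e) k d) fun m s => by
      by_cases hk : m = k
      · subst hk
        simp [hd]
      · by_cases hl : m = l
        · subst hl
          simp [hk, he]
        · simp [hk, hl, hz]
  have h2 : ∀ i : ∀ γ, I γ, ∏ m,
      (1 + Function.update (Function.update z l e) k d m ((S m).restrict i) ((R m).restrict i))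
      = (1 + d ((S k).restrict i) ((R k).restrict i)) *
        (1 + e ((S l).restrict i) ((R l).restrict i)) := by
    intro i
    rw [Fintype.prod_eq_mul k l hkl fun m hm => by simp [hm.1, hm.2, hz]]
    simp [hkl.symm]
  have h3 := h.sum_chainProd_mul_eq_zero i₀ hT hd
  have h4 := h.sum_chainProd_mul_eq_zero i₀ hT he
  have h5 : ∀ i : ∀ γ, I γ, chainProd T i * ((1 + d ((S k).restrict i) ((R k).restrict i)) *
        (1 + e ((S l).restrict i) ((R l).restrict i)))
      = chainProd T i + chainProd T i * d ((S k).restrict i) ((R k).restrict i)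
        + chainProd T i * e ((S l).restrict i) ((R l).restrict i)
        + chainProd T i * (d ((S k).restrict i) ((R k).restrict i) *
          e ((S l).restrict i) ((R l).restrict i)) := fun i => by ring
  simp only [h2, h5, Finset.sum_add_distrib, h.sum_chainProd i₀ hT, h3, h4] at h1
  linarith

theorem IsPerfectSequence.sum_chainProd_mul (h : IsPerfectSequence G S R ord)
    (i₀ : ∀ γ, I γ) (hT : ∀ l s, ∑ r, T l s r = 1) (l : Λ) (F : Cell I (S l) → Cell I (R l) → ℝ) :
    ∑ i, chainProd T i * F ((S l).restrict i) ((R l).restrict i)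
      = ∑ i, chainProd T i * ∑ r, T l ((S l).restrict i) r * F ((S l).restrict i) r := by
  have h1 := h.sum_chainProd_mul_eq_zero i₀ hT (l := l)
    (e := fun s r => F s r - ∑ x, T l s x * F s x) fun s => by
      simp only [mul_sub, Finset.sum_sub_distrib]
      rw [← Finset.sum_mul, hT, one_mul, sub_self]
  simp only [mul_sub, Finset.sum_sub_distrib] at h1
  exact sub_eq_zero.1 h1

theorem IsPerfectSequence.sum_chainProd_mul_slice (h : IsPerfectSequence G S R ord)
    (i₀ : ∀ γ, I γ) (hT : ∀ l s, ∑ r, T l s r = 1) (l : Λ) (s : Cell I (S l))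
    (F : Cell I (R l) → ℝ) :
    ∑ i, chainProd T i * (if (S l).restrict i = s then F ((R l).restrict i) else 0)
      = marginal (chainProd T) (S l) s * ∑ r, T l s r * F r := by
  rw [h.sum_chainProd_mul i₀ hT l fun s' r => if s' = s then F r else 0, marginal,
    Finset.sum_mul, Finset.sum_filter]
  refine Finset.sum_congr rfl fun i _ => ?_
  split_ifs with hi
  · simp [hi]
  · simp

theorem chainProd_pos (hpos : ∀ l s r, 0 < T l s r) (i : ∀ γ, I γ) : 0 < chainProd T i :=
  Finset.prod_pos fun _ _ => hpos _ _ _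

theorem IsPerfectSequence.conditional_chainProd (h : IsPerfectSequence G S R ord)
    (i₀ : ∀ γ, I γ) (hT : ∀ l s, ∑ r, T l s r = 1) (hpos : ∀ l s r, 0 < T l s r) (l : Λ)
    (s : Cell I (S l)) (r : Cell I (R l)) :
    conditional (chainProd T) (R l) (S l) s r = T l s r := by
  have h1 := h.sum_chainProd_mul_slice i₀ hT l s fun x => if x = r then 1 else 0
  simp only [mul_ite, mul_one, mul_zero, Finset.sum_ite_eq', Finset.mem_univ, if_true] at h1
  rw [conditional, div_eq_iff (marginal_pos (chainProd_pos hpos) i₀ _ s).ne', mul_comm, ← h1,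
    Finset.sum_filter]
  refine Finset.sum_congr rfl fun i _ => ?_
  by_cases h2 : (S l).restrict i = s <;> by_cases h3 : (R l).restrict i = r <;> simp [h2, h3]

/-- The marginal of a separator does not depend on the tables conditioned on its cells. -/
theorem IsPerfectSequence.marginal_chainProd_congr (h : IsPerfectSequence G S R ord)
    (i₀ : ∀ γ, I γ) (hT : ∀ l s, ∑ r, T l s r = 1) (hpos : ∀ l s r, 0 < T l s r)
    {T' : ∀ l, Cell I (S l) → Cell I (R l) → ℝ} (hT' : ∀ l s, ∑ r, T' l s r = 1) {l : Λ}
    {s : Cell I (S l)} (hTT' : ∀ k x r, (⟨k, x⟩ : Σ k, Cell I (S k)) ≠ ⟨l, s⟩ →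
      T' k x r = T k x r) :
    marginal (chainProd T') (S l) s = marginal (chainProd T) (S l) s := by
  have h1 : ∀ i : ∀ γ, I γ, (S l).restrict i = s → chainProd T' i = chainProd T i +
      chainProd T i * (if (S l).restrict i = s then
        (T' l s ((R l).restrict i) / T l s ((R l).restrict i) - 1) else 0) := by
    intro i hi
    rw [if_pos hi, ← mul_one_add, add_sub_cancel, chainProd, chainProd,
      ← Finset.mul_prod_erase _ _ (Finset.mem_univ l),
      ← Finset.mul_prod_erase _ _ (Finset.mem_univ l), hi,
      Finset.prod_congr rfl fun k hk => hTT' k _ _ fun e =>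
        Finset.ne_of_mem_erase hk (congrArg Sigma.fst e)]
    have := (hpos l s ((R l).restrict i)).ne'
    field_simp
  have h2 := h.sum_chainProd_mul_slice i₀ hT l s fun r => T' l s r / T l s r - 1
  have h3 : ∀ r, T l s r * (T' l s r / T l s r - 1) = T' l s r - T l s r := by
    intro r
    have := (hpos l s r).ne'
    field_simp
  simp only [h3, Finset.sum_sub_distrib, hT, hT', sub_self, mul_zero] at h2
  rw [marginal, Finset.sum_congr rfl fun i hi => h1 i (Finset.mem_filter.1 hi).2,
    Finset.sum_add_distrib, ← marginal, Finset.sum_filter, add_eq_left]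
  refine Eq.trans (Finset.sum_congr rfl fun i _ => ?_) h2
  split_ifs <;> simp

theorem IsPerfectSequence.chainProd_mem_markovModel (h : IsPerfectSequence G S R ord)
    (i₀ : ∀ γ, I γ) (hT : ∀ l s, ∑ r, T l s r = 1) (hpos : ∀ l s r, 0 < T l s r) :
    chainProd T ∈ markovModel G := by
  refine mem_markovModel_of_factorization (C := fun l => S l ∪ R l) h.isClique
    (φ := fun l i => T l ((S l).restrict i) ((R l).restrict i)) (fun l i j hij => ?_)
    (fun l i => hpos _ _ _) (h.sum_chainProd i₀ hT)
  have h1 : (S l).restrict i = (S l).restrict j :=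
    restrict_eq_restrict_iff.2 fun γ hγ => hij γ (by simp [hγ])
  have h2 : (R l).restrict i = (R l).restrict j :=
    restrict_eq_restrict_iff.2 fun γ hγ => hij γ (by simp [hγ])
  simp only [h1, h2]

/-- A Markov table is determined by its conditional tables along the sequence. -/
theorem IsPerfectSequence.markovModel_ext (h : IsPerfectSequence G S R ord) (i₀ : ∀ γ, I γ)
    {p p' : (∀ γ, I γ) → ℝ} (hp : p ∈ markovModel G) (hp' : p' ∈ markovModel G)
    (hpp' : ∀ l s r, conditional p (R l) (S l) s r = conditional p' (R l) (S l) s r) : p = p' := by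
  have key : ∀ n l, ord l = n → ∀ f : (∀ γ, I γ) → ℝ,
      DependsOn f ((S l ∪ R l : Finset V) : Set V) → ∑ i, p i * f i = ∑ i, p' i * f i := by
    intro n
    induction n using Nat.strong_induction_on with
    | _ n ih =>
      intro l hn f hf
      set F : Cell I (S l) → Cell I (R l) → ℝ := fun s r => f (glue (R l) (glue (S l) i₀ s) r)
        with hF
      have hfF : ∀ i, f i = F ((S l).restrict i) ((R l).restrict i) := by
        intro i
        refine hf fun γ hγ => ?_
        by_cases h1 : γ ∈ R l
        · simp [glue, h1]
        · have h2 : γ ∈ S l := by simpa [h1] using hγ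
          simp [glue, h1, h2]
      simp only [hfF]
      rw [sum_mul_restrict_restrict hp.1 i₀, sum_mul_restrict_restrict hp'.1 i₀]
      simp only [hpp']
      set g : (∀ γ, I γ) → ℝ := fun i =>
        ∑ r, conditional p' (R l) (S l) ((S l).restrict i) r * F ((S l).restrict i) r with hg
      have hgS : DependsOn g (S l : Set V) := by
        intro i j hij
        have : (S l).restrict i = (S l).restrict j :=
          restrict_eq_restrict_iff.2 fun γ hγ => hij γ hγ
        simp only [hg, this]
      rcases h.separator_subset l with h0 | ⟨k, hk, hSk⟩
      · have hconst : ∀ i, g i = g i₀ := fun i => hgS fun γ hγ => by simp [h0] at hγ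
        change ∑ i, p i * g i = ∑ i, p' i * g i
        simp only [hconst]
        rw [← Finset.sum_mul, ← Finset.sum_mul, hp.2.1, hp'.2.1]
      · exact ih _ (hn ▸ hk) k rfl g fun i j hij => hgS fun γ hγ => hij γ (hSk hγ)
  refine RefPrior.markovModel_ext hp hp' fun D hD f hf => ?_
  obtain ⟨l, hl⟩ := h.exists_subset D hD
  exact key _ l rfl f fun i j hij => hf fun γ hγ => hij γ (hl hγ)

end Chain

/-! ### Perfect sequences that belong to a cut -/

section PerfectOrdering

theorem exists_isCliqueOf_superset {V : Type*} [Finite V] {G : SimpleGraph V}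
    {U D : Finset V} (hDU : D ⊆ U)
    (hD : G.IsClique (D : Set V)) : ∃ K, IsCliqueOf G U K ∧ D ⊆ K := by
  obtain ⟨K, hDK, hK⟩ := Finite.exists_le_maximal
    (p := fun K : Finset V => K ⊆ U ∧ G.IsClique (K : Set V)) ⟨hDU, hD⟩
  exact ⟨K, hK, hDK⟩

variable {V : Type*} [DecidableEq V] {G : SimpleGraph V}

variable {U : Finset V} {k : ℕ} {C : Fin k → Finset V}

theorem IsPerfectOrdering.isCliqueOf (h : IsPerfectOrdering G U C) (l : Fin k) :
    IsCliqueOf G U (C l) :=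
  (h.mem_range_iff _).1 ⟨l, rfl⟩

theorem IsPerfectOrdering.exists_subset [Finite V] (h : IsPerfectOrdering G U C)
    {D : Finset V} (hDU : D ⊆ U)
    (hD : G.IsClique (D : Set V)) : ∃ l, D ⊆ C l := by
  obtain ⟨K, hK, hDK⟩ := exists_isCliqueOf_superset hDU hD
  obtain ⟨l, rfl⟩ := (h.mem_range_iff K).2 hK
  exact ⟨l, hDK⟩

theorem subset_history {j l : Fin k} (hjl : j < l) : C j ⊆ history C l :=
  Finset.subset_biUnion_of_mem C (by simpa using hjl)

theorem separator_union_residual {F : Finset V} (hF : ∀ j : Fin k, (j : ℕ) = 0 → F ⊆ C j)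
    (l : Fin k) : separator F C l ∪ residual F C l = C l := by
  have : separator F C l ⊆ C l := by
    unfold separator
    split_ifs with h
    · exact hF l h
    · exact Finset.inter_subset_left
  rw [residual, Finset.union_sdiff_of_subset this]

theorem disjoint_separator_residual (F : Finset V) (l : Fin k) :
    Disjoint (separator F C l) (residual F C l) :=
  Finset.disjoint_sdiff

theorem disjoint_residual_of_lt (F : Finset V) {j l : Fin k} (hjl : j < l) :
    Disjoint (C j) (residual F C l) := by
  have h0 : (l : ℕ) ≠ 0 := by
    have := Fin.lt_def.1 hjl
    omega
  rw [Finset.disjoint_left]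
  intro γ hγ hγl
  simp only [residual, separator, h0, if_false, Finset.mem_sdiff, Finset.mem_inter, not_and] at hγl
  exact hγl.2 hγl.1 (subset_history hjl hγ)

end PerfectOrdering

section Components

variable {V : Type*} {G : SimpleGraph V} {A B B' : Finset V}

theorem IsComponentOff.disjoint_cut (h : IsComponentOff G A B) : Disjoint A B := by
  obtain ⟨c, hc⟩ := h
  rw [Finset.disjoint_right]
  intro v hv
  have : v ∈ (B : Set V) := hv
  rw [hc] at this
  obtain ⟨⟨w, hw⟩, -, rfl⟩ := this
  exact hw

theorem IsComponentOff.mem_of_adj (h : IsComponentOff G A B) {v w : V} (hv : v ∈ B) (hw : w ∉ A)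
    (hvw : G.Adj v w) : w ∈ B := by
  obtain ⟨c, hc⟩ := h
  have hv' : v ∈ (B : Set V) := hv
  change w ∈ (B : Set V)
  rw [hc] at hv' ⊢
  obtain ⟨x, hx, rfl⟩ := hv'
  refine ⟨⟨w, hw⟩, ?_, rfl⟩
  rw [SimpleGraph.ConnectedComponent.mem_supp_iff] at hx ⊢
  rw [← hx, SimpleGraph.ConnectedComponent.eq]
  exact SimpleGraph.Adj.reachable (by simpa using hvw.symm)

theorem IsComponentOff.eq_of_mem (h : IsComponentOff G A B) (h' : IsComponentOff G A B') {v : V}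
    (hv : v ∈ B) (hv' : v ∈ B') : B = B' := by
  obtain ⟨c, hc⟩ := h
  obtain ⟨c', hc'⟩ := h'
  rw [← Finset.mem_coe, hc] at hv
  rw [← Finset.mem_coe, hc'] at hv'
  obtain ⟨x, hx, rfl⟩ := hv
  obtain ⟨y, hy, hxy⟩ := hv'
  obtain rfl : y = x := Subtype.ext hxy
  rw [SimpleGraph.ConnectedComponent.mem_supp_iff] at hx hy
  rw [← Finset.coe_inj, hc, hc', ← hx, ← hy]

variable [Fintype V]

theorem exists_isComponentOff {v : V} (hv : v ∉ A) : ∃ B, IsComponentOff G A B ∧ v ∈ B := by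
  classical
  set c := (G.induce {v | v ∉ A}).connectedComponentMk ⟨v, hv⟩
  refine ⟨(Subtype.val '' c.supp).toFinset, ⟨c, by simp⟩, ?_⟩
  rw [Set.mem_toFinset]
  exact ⟨⟨v, hv⟩, rfl, rfl⟩

variable [DecidableEq V]

theorem mem_boundary {v : V} : v ∈ boundary G B ↔ v ∉ B ∧ ∃ w ∈ B, G.Adj v w := by
  simp [boundary]

theorem IsComponentOff.boundary_subset (h : IsComponentOff G A B) : boundary G B ⊆ A := by
  intro v hv
  obtain ⟨hvB, w, hw, hvw⟩ := mem_boundary.1 hv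
  by_contra hvA
  exact hvB (h.mem_of_adj hw hvA hvw.symm)

end Components

namespace CutOrdering

variable {V : Type*} [Fintype V] [DecidableEq V] {G : SimpleGraph V} {A : Finset V}

/-- Index set of the cliques of a cut ordering: those of `G_A` and those that belong to the
components off `A`. -/
abbrev Block (c : CutOrdering G A) := Fin c.q ⊕ (Σ l : Fin c.p, Fin (c.m l))

/-- The separator of a clique. -/
noncomputable def blockSep (c : CutOrdering G A) : c.Block → Finset V
  | .inl l => separator ∅ c.CA l
  | .inr x => separator (boundary G (c.B x.1)) (c.CB x.1) x.2

/-- The residual of a clique. -/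
noncomputable def blockRes (c : CutOrdering G A) : c.Block → Finset V
  | .inl l => residual ∅ c.CA l
  | .inr x => residual (boundary G (c.B x.1)) (c.CB x.1) x.2

/-- The position of a clique: the cliques of `G_A` come first.  The cliques of different components
may have the same position. -/
def blockOrd (c : CutOrdering G A) : c.Block → ℕ
  | .inl l => l
  | .inr x => c.q + x.2

theorem isComponentOff (c : CutOrdering G A) (l : Fin c.p) : IsComponentOff G A (c.B l) :=
  (c.mem_range_B _).1 ⟨l, rfl⟩

theorem blockSep_union_blockRes_inl (c : CutOrdering G A) (l : Fin c.q) :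
    c.blockSep (.inl l) ∪ c.blockRes (.inl l) = c.CA l :=
  separator_union_residual (fun _ _ => Finset.empty_subset _) l

theorem blockSep_union_blockRes_inr (c : CutOrdering G A) (x : Σ l : Fin c.p, Fin (c.m l)) :
    c.blockSep (.inr x) ∪ c.blockRes (.inr x) = c.CB x.1 x.2 :=
  separator_union_residual (c.boundary_subset x.1) x.2

theorem exists_zero (c : CutOrdering G A) (l : Fin c.p) : ∃ j : Fin (c.m l), (j : ℕ) = 0 := by
  obtain ⟨j, -⟩ := (c.perfectB l).exists_subset (Finset.empty_subset _) (by simp)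
  exact ⟨⟨0, by have := j.2; omega⟩, rfl⟩

/-- The first clique of a component contains its boundary, and the later residuals
avoid the first clique. -/
theorem blockRes_inr_subset (c : CutOrdering G A) (x : Σ l : Fin c.p, Fin (c.m l)) :
    c.blockRes (.inr x) ⊆ c.B x.1 := by
  intro γ hγ
  have hC : γ ∈ c.CB x.1 x.2 := (Finset.mem_sdiff.1 hγ).1
  have hU := (((c.perfectB x.1).isCliqueOf x.2).prop.1) hC
  refine (Finset.mem_union.1 hU).resolve_right fun hb => ?_
  obtain ⟨j, hj⟩ := c.exists_zero x.1
  by_cases h0 : (x.2 : ℕ) = 0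
  · have := (Finset.mem_sdiff.1 hγ).2
    rw [separator, if_pos h0] at this
    exact this hb
  · have hlt : j < x.2 := by
      rw [Fin.lt_def]
      omega
    exact Finset.disjoint_left.1 (disjoint_residual_of_lt _ hlt) (c.boundary_subset x.1 j hj hb) hγ

theorem isClique_boundary (c : CutOrdering G A) (l : Fin c.p) :
    G.IsClique (boundary G (c.B l) : Set V) := by
  obtain ⟨j, hj⟩ := c.exists_zero l
  exact ((c.perfectB l).isCliqueOf j).prop.2.subset (by exact_mod_cast c.boundary_subset l j hj)

/-- The cliques of `G_A`, followed by those of the components, form a perfect sequence: each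
component is attached to `A` along its boundary, which is complete since the first clique of the
component contains it. -/
theorem isPerfectSequence (c : CutOrdering G A) :
    IsPerfectSequence G c.blockSep c.blockRes c.blockOrd where
  disjoint := by
    rintro (l | x)
    · exact disjoint_separator_residual _ _
    · exact disjoint_separator_residual _ _
  disjoint_of_le := by
    rintro (k | x) (l | y) hne hle
    · rw [blockSep_union_blockRes_inl]
      refine disjoint_residual_of_lt _ (lt_of_le_of_ne hle fun e => hne ?_)
      rw [e]
    · rw [blockSep_union_blockRes_inl]
      exact (c.isComponentOff y.1).disjoint_cut.mono ((c.perfectA.isCliqueOf k).prop.1)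
        (c.blockRes_inr_subset y)
    · have := l.2
      simp only [blockOrd] at hle
      omega
    · rw [blockSep_union_blockRes_inr]
      obtain ⟨l, i⟩ := x
      obtain ⟨l', j⟩ := y
      by_cases hl : l = l'
      · subst hl
        refine disjoint_residual_of_lt _ (lt_of_le_of_ne ?_ fun e => hne ?_)
        · simpa [blockOrd] using hle
        · simp only at e
          rw [e]
      · have hU := ((c.perfectB l).isCliqueOf i).prop.1
        refine Disjoint.mono hU (c.blockRes_inr_subset ⟨l', j⟩) ?_
        rw [Finset.disjoint_union_left]
        constructor
        · rw [Finset.disjoint_left]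
          intro v hv hv'
          exact hl (c.injective_B ((c.isComponentOff l).eq_of_mem (c.isComponentOff l') hv hv'))
        · exact (c.isComponentOff l').disjoint_cut.mono_left (c.isComponentOff l).boundary_subset
  isClique := by
    rintro (l | x)
    · rw [blockSep_union_blockRes_inl]
      exact (c.perfectA.isCliqueOf l).prop.2
    · rw [blockSep_union_blockRes_inr]
      exact ((c.perfectB x.1).isCliqueOf x.2).prop.2
  separator_subset := by
    rintro (l | x)
    · by_cases h0 : (l : ℕ) = 0
      · left
        simp [blockSep, separator, h0]
      · right
        obtain ⟨i, hi, hsub⟩ := c.perfectA.perfect l h0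
        refine ⟨.inl i, hi, ?_⟩
        rw [blockSep_union_blockRes_inl]
        simpa [blockSep, separator, h0] using hsub
    · right
      by_cases h0 : (x.2 : ℕ) = 0
      · obtain ⟨k, hk⟩ := c.perfectA.exists_subset (c.isComponentOff x.1).boundary_subset
          (c.isClique_boundary x.1)
        refine ⟨.inl k, ?_, ?_⟩
        · have := k.2
          simp only [blockOrd]
          omega
        · rw [blockSep_union_blockRes_inl]
          simpa [blockSep, separator, h0] using hk
      · obtain ⟨i, hi, hsub⟩ := (c.perfectB x.1).perfect x.2 h0
        refine ⟨.inr ⟨x.1, i⟩, by simpa [blockOrd] using hi, ?_⟩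
        rw [blockSep_union_blockRes_inr]
        simpa [blockSep, separator, h0] using hsub
  exists_subset := by
    intro D hD
    by_cases hDA : D ⊆ A
    · obtain ⟨l, hl⟩ := c.perfectA.exists_subset hDA hD
      exact ⟨.inl l, by rwa [blockSep_union_blockRes_inl]⟩
    · obtain ⟨v, hvD, hvA⟩ := Finset.not_subset.1 hDA
      obtain ⟨B, hB, hvB⟩ := exists_isComponentOff (G := G) hvA
      obtain ⟨l, rfl⟩ := (c.mem_range_B B).2 hB
      have hDU : D ⊆ c.B l ∪ boundary G (c.B l) := by
        intro w hw
        rw [Finset.mem_union, mem_boundary]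
        by_cases hwB : w ∈ c.B l
        · exact .inl hwB
        · refine .inr ⟨hwB, v, hvB, hD hw hvD ?_⟩
          rintro rfl
          exact hwB hvB
      obtain ⟨j, hj⟩ := (c.perfectB l).exists_subset hDU hD
      exact ⟨.inr ⟨l, j⟩, by rwa [blockSep_union_blockRes_inr]⟩

end CutOrdering

/-! ### Tables in terms of their free coordinates -/

section FullTable

variable {α : Type*} [DecidableEq α] (a₀ : α)

/-- The derivative of the whole table in the direction of the free coordinate `r`. -/
def tableDeriv (r : {a // a ≠ a₀}) (a : α) : ℝ :=
  (if a = r then 1 else 0) - if a = a₀ then 1 else 0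

theorem tableDeriv_self (r : {a // a ≠ a₀}) : tableDeriv a₀ r a₀ = -1 := by
  simp [tableDeriv, r.2.symm]

theorem tableDeriv_coe (r x : {a // a ≠ a₀}) : tableDeriv a₀ r x = if x = r then 1 else 0 := by
  simp [tableDeriv, x.2, Subtype.ext_iff]

variable [Fintype α]

/-- The whole table whose cells other than the reference cell `a₀` are given by `t`. -/
def fullTable (t : {a // a ≠ a₀} → ℝ) (a : α) : ℝ :=
  if h : a ≠ a₀ then t ⟨a, h⟩ else 1 - ∑ x, t x

theorem fullTable_coe (t : {a // a ≠ a₀} → ℝ) (r : {a // a ≠ a₀}) :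
    fullTable a₀ t r = t r := by
  simp [fullTable, r.2]

theorem fullTable_self (t : {a // a ≠ a₀} → ℝ) : fullTable a₀ t a₀ = 1 - ∑ x, t x := by
  simp [fullTable]

theorem fullTable_pos {t : {a // a ≠ a₀} → ℝ} (ht : t ∈ openSimplex {a // a ≠ a₀}) (a : α) :
    0 < fullTable a₀ t a := by
  unfold fullTable
  split_ifs with h
  · exact ht.1 _
  · exact sub_pos.2 ht.2

theorem sum_fullTable (t : {a // a ≠ a₀} → ℝ) : ∑ a, fullTable a₀ t a = 1 := by
  rw [Fintype.sum_eq_add_sum_subtype_ne _ a₀, fullTable_self]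
  simp only [fullTable_coe, sub_add_cancel]

theorem fullTable_of_sum_eq_one {T : α → ℝ} (hT : ∑ a, T a = 1) (a : α) :
    fullTable a₀ (fun r => T r) a = T a := by
  by_cases h : a = a₀
  · subst h
    rw [Fintype.sum_eq_add_sum_subtype_ne _ a] at hT
    rw [fullTable_self]
    linarith
  · exact fullTable_coe a₀ _ ⟨a, h⟩

theorem mem_openSimplex_of_pos {T : α → ℝ} (hT : ∑ a, T a = 1) (hpos : ∀ a, 0 < T a) :
    (fun r : {a // a ≠ a₀} => T r) ∈ openSimplex {a // a ≠ a₀} := by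
  refine ⟨fun r => hpos r, ?_⟩
  have := hpos a₀
  rw [Fintype.sum_eq_add_sum_subtype_ne _ a₀] at hT
  linarith

theorem sum_tableDeriv (r : {a // a ≠ a₀}) : ∑ a, tableDeriv a₀ r a = 0 := by
  simp [tableDeriv]

theorem fullTable_add_single (t : {a // a ≠ a₀} → ℝ) (ε : ℝ) (r : {a // a ≠ a₀}) (a : α) :
    fullTable a₀ (t + ε • Pi.single r 1) a = fullTable a₀ t a + ε * tableDeriv a₀ r a := by
  by_cases h : a = a₀
  · subst h
    rw [fullTable_self, fullTable_self, tableDeriv_self]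
    simp only [Pi.add_apply, Pi.smul_apply, smul_eq_mul, Finset.sum_add_distrib, ← Finset.mul_sum,
      Finset.sum_pi_single', Finset.mem_univ, if_true]
    ring
  · lift a to {a // a ≠ a₀} using h
    rw [fullTable_coe, fullTable_coe, tableDeriv_coe]
    simp [Pi.single_apply]

theorem sum_tableDeriv_mul_tableDeriv {t : {a // a ≠ a₀} → ℝ}
    (ht : t ∈ openSimplex {a // a ≠ a₀}) (r r' : {a // a ≠ a₀}) :
    ∑ a, fullTable a₀ t a * (tableDeriv a₀ r a / fullTable a₀ t a *
        (tableDeriv a₀ r' a / fullTable a₀ t a))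
      = (if r = r' then (t r)⁻¹ else 0) + (fullTable a₀ t a₀)⁻¹ := by
  have h0 : ∀ a, fullTable a₀ t a * (tableDeriv a₀ r a / fullTable a₀ t a *
        (tableDeriv a₀ r' a / fullTable a₀ t a))
      = tableDeriv a₀ r a * tableDeriv a₀ r' a * (fullTable a₀ t a)⁻¹ := by
    intro a
    have := (fullTable_pos a₀ ht a).ne'
    field_simp
  simp only [h0]
  rw [Fintype.sum_eq_add_sum_subtype_ne _ a₀, tableDeriv_self, tableDeriv_self, add_comm]
  congr 1
  · simp only [tableDeriv_coe, fullTable_coe, ite_mul, one_mul, zero_mul, Finset.sum_ite_eq',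
      Finset.mem_univ, if_true]
  · ring

/-- The Jeffreys weight of a table. -/
noncomputable def tableWeight (t : {a // a ≠ a₀} → ℝ) : ℝ :=
  ∏ a, fullTable a₀ t a ^ (-(1 / 2) : ℝ)

theorem tableWeight_pos {t : {a // a ≠ a₀} → ℝ} (ht : t ∈ openSimplex {a // a ≠ a₀}) :
    0 < tableWeight a₀ t :=
  Finset.prod_pos fun a _ => Real.rpow_pos_of_pos (fullTable_pos a₀ ht a) _

theorem differentiable_fullTable (a : α) :
    Differentiable ℝ fun t : {a // a ≠ a₀} → ℝ => fullTable a₀ t a := by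
  unfold fullTable
  split_ifs with h
  · exact differentiable_apply _
  · exact (differentiable_const _).sub (Differentiable.fun_sum fun r _ => differentiable_apply r)

theorem continuousOn_tableWeight :
    ContinuousOn (tableWeight a₀) (openSimplex {a // a ≠ a₀}) := by
  refine continuousOn_finsetProd _ fun a _ => ?_
  exact (differentiable_fullTable a₀ a).continuous.continuousOn.rpow_const fun t ht =>
    .inl (fullTable_pos a₀ ht a).ne'

theorem log_det_table {t : {a // a ≠ a₀} → ℝ} (ht : t ∈ openSimplex {a // a ≠ a₀}) :
    Real.log (Matrix.of fun r r' : {a // a ≠ a₀} =>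
        (if r = r' then (t r)⁻¹ else 0) + (fullTable a₀ t a₀)⁻¹ : Matrix _ _ ℝ).det
      = 2 * Real.log (tableWeight a₀ t) := by
  have hpos := fullTable_pos a₀ ht
  rw [det_diagonal_add_const (fun r => (ht.1 r).ne') (hpos a₀).ne'
    (by rw [fullTable_self, sub_add_cancel])]
  have h1 : (fullTable a₀ t a₀)⁻¹ * ∏ r, (t r)⁻¹ = ∏ a, (fullTable a₀ t a)⁻¹ := by
    rw [Fintype.prod_eq_mul_prod_subtype_ne _ a₀]
    simp only [fullTable_coe]
  rw [h1, tableWeight, Real.log_prod fun a _ => (inv_pos.2 (hpos a)).ne',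
    Real.log_prod fun a _ => (Real.rpow_pos_of_pos (hpos a) _).ne', Finset.mul_sum]
  refine Finset.sum_congr rfl fun a _ => ?_
  rw [Real.log_inv, Real.log_rpow (hpos a)]
  ring

end FullTable

theorem differentiable_finsetProd {ι E : Type*} [NormedAddCommGroup E] [NormedSpace ℝ E]
    {f : ι → E → ℝ} (u : Finset ι) (hf : ∀ i, Differentiable ℝ (f i)) :
    Differentiable ℝ fun x => ∏ i ∈ u, f i x := by
  classical
  exact fun x => (HasFDerivAt.finsetProd fun i _ => (hf i x).hasFDerivAt).differentiableAt

namespace CutOrdering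

variable {V : Type*} [Fintype V] [DecidableEq V] {I : V → Type*} [∀ γ, Fintype (I γ)]
  [∀ γ, DecidableEq (I γ)] {G : SimpleGraph V} {A : Finset V}

/-! ### The parametrization by conditional tables -/

/-- The parameter space: each group lies in its open simplex. -/
def paramSpace (c : CutOrdering G A) (istar : ∀ γ, I γ) :
    Set (∀ g : c.Group I, c.Coord istar g → ℝ) :=
  {θ | ∀ g, θ g ∈ c.simplex istar g}

/-- The tables of the parameter `θ`, indexed by clique and cell of the separator. -/
noncomputable def tables (c : CutOrdering G A) (istar : ∀ γ, I γ)
    (θ : ∀ g : c.Group I, c.Coord istar g → ℝ) :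
    ∀ k, Cell I (c.blockSep k) → Cell I (c.blockRes k) → ℝ
  | .inl l => fun s r => c.table istar θ (.inl ⟨l, s⟩) r
  | .inr x => fun s r => c.table istar θ (.inr ⟨x.1, x.2, s⟩) r

/-- The table of joint probabilities with the conditional tables `θ`, as an explicit product. -/
noncomputable def jointTable (c : CutOrdering G A) (istar : ∀ γ, I γ)
    (θ : ∀ g : c.Group I, c.Coord istar g → ℝ) : (∀ γ, I γ) → ℝ :=
  chainProd (c.tables istar θ)

variable (c : CutOrdering G A) (istar : ∀ γ, I γ) {θ : ∀ g : c.Group I, c.Coord istar g → ℝ}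

theorem table_eq_fullTable (θ : ∀ g : c.Group I, c.Coord istar g → ℝ) (g : c.Group I) :
    c.table istar θ g = fullTable (Finset.restrict (c.res g) istar) (θ g) :=
  rfl

theorem table_pos (hθ : θ ∈ c.paramSpace istar) (g : c.Group I) (r : Cell I (c.res g)) :
    0 < c.table istar θ g r :=
  fullTable_pos _ (hθ g) r

theorem sum_table (θ : ∀ g : c.Group I, c.Coord istar g → ℝ) (g : c.Group I) :
    ∑ r, c.table istar θ g r = 1 :=
  sum_fullTable _ (θ g)

theorem tables_pos (hθ : θ ∈ c.paramSpace istar) (k : c.Block) (s : Cell I (c.blockSep k))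
    (r : Cell I (c.blockRes k)) : 0 < c.tables istar θ k s r := by
  rcases k with l | x
  · exact c.table_pos istar hθ (.inl ⟨l, s⟩) r
  · exact c.table_pos istar hθ (.inr ⟨x.1, x.2, s⟩) r

theorem sum_tables (θ : ∀ g : c.Group I, c.Coord istar g → ℝ) (k : c.Block)
    (s : Cell I (c.blockSep k)) : ∑ r, c.tables istar θ k s r = 1 := by
  rcases k with l | x
  · exact c.sum_table istar θ (.inl ⟨l, s⟩)
  · exact c.sum_table istar θ (.inr ⟨x.1, x.2, s⟩)

theorem disjoint_sep_res (g : c.Group I) : Disjoint (c.sep g) (c.res g) := by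
  rcases g with ⟨l, s⟩ | ⟨l, j, s⟩
  · exact c.isPerfectSequence.disjoint (.inl l)
  · exact c.isPerfectSequence.disjoint (.inr ⟨l, j⟩)

theorem table_param {p : (∀ γ, I γ) → ℝ} (hp : ∀ i, 0 < p i) (g : c.Group I)
    (r : Cell I (c.res g)) :
    c.table istar (c.param istar p) g r = conditional p (c.res g) (c.sep g) (c.slice g) r :=
  fullTable_of_sum_eq_one _ (sum_conditional hp istar _ _ _) r

theorem tables_param {p : (∀ γ, I γ) → ℝ} (hp : ∀ i, 0 < p i) (k : c.Block)
    (s : Cell I (c.blockSep k)) (r : Cell I (c.blockRes k)) :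
    c.tables istar (c.param istar p) k s r = conditional p (c.blockRes k) (c.blockSep k) s r := by
  rcases k with l | x
  · exact c.table_param istar hp (.inl ⟨l, s⟩) r
  · exact c.table_param istar hp (.inr ⟨x.1, x.2, s⟩) r

theorem param_mem_paramSpace {p : (∀ γ, I γ) → ℝ} (hp : ∀ i, 0 < p i) :
    c.param istar p ∈ c.paramSpace istar := fun g =>
  mem_openSimplex_of_pos _ (sum_conditional hp istar _ _ _)
    fun _ => conditional_pos hp istar (c.disjoint_sep_res g) _ _

theorem jointTable_pos (hθ : θ ∈ c.paramSpace istar) (i : ∀ γ, I γ) :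
    0 < c.jointTable istar θ i :=
  chainProd_pos (c.tables_pos istar hθ) i

theorem sum_jointTable (θ : ∀ g : c.Group I, c.Coord istar g → ℝ) :
    ∑ i, c.jointTable istar θ i = 1 :=
  c.isPerfectSequence.sum_chainProd istar (c.sum_tables istar θ)

theorem jointTable_mem_markovModel (hθ : θ ∈ c.paramSpace istar) :
    c.jointTable istar θ ∈ markovModel G :=
  c.isPerfectSequence.chainProd_mem_markovModel istar (c.sum_tables istar θ)
    (c.tables_pos istar hθ)

theorem param_jointTable (hθ : θ ∈ c.paramSpace istar) :
    c.param istar (c.jointTable istar θ) = θ := by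
  have key := c.isPerfectSequence.conditional_chainProd istar (c.sum_tables istar θ)
    (c.tables_pos istar hθ)
  ext g r
  rcases g with ⟨l, s⟩ | ⟨l, j, s⟩
  · exact (key (.inl l) s r.1).trans (fullTable_coe _ _ r)
  · exact (key (.inr ⟨l, j⟩) s r.1).trans (fullTable_coe _ _ r)

theorem injOn_param : Set.InjOn (c.param istar) (markovModel (I := I) G) := by
  intro p hp p' hp' h
  refine c.isPerfectSequence.markovModel_ext istar hp hp' fun k s r => ?_
  rw [← c.tables_param istar hp.1, ← c.tables_param istar hp'.1, h]

theorem bijOn_param :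
    Set.BijOn (c.param istar) (markovModel (I := I) G) (c.paramSpace istar) :=
  ⟨fun _ hp => c.param_mem_paramSpace istar hp.1, c.injOn_param istar,
    fun θ hθ => ⟨c.jointTable istar θ, c.jointTable_mem_markovModel istar hθ,
      c.param_jointTable istar hθ⟩⟩

theorem joint_eq_jointTable (hθ : θ ∈ c.paramSpace istar) :
    c.joint istar θ = c.jointTable istar θ := by
  have hmem : ∃ p ∈ markovModel (I := I) G, c.param istar p = θ :=
    ⟨_, c.jointTable_mem_markovModel istar hθ, c.param_jointTable istar hθ⟩
  have : Nonempty ((∀ γ, I γ) → ℝ) := ⟨0⟩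
  refine c.injOn_param istar (Function.invFunOn_mem hmem)
    (c.jointTable_mem_markovModel istar hθ) ?_
  rw [c.param_jointTable istar hθ]
  exact Function.invFunOn_eq hmem

/-! ### Expectations of functions of one table -/

/-- The probability of the cell on which a group is conditioned. -/
noncomputable def sliceProb (θ : ∀ g : c.Group I, c.Coord istar g → ℝ) (g : c.Group I) : ℝ :=
  marginal (c.jointTable istar θ) (c.sep g) (c.slice g)

theorem sliceProb_pos (hθ : θ ∈ c.paramSpace istar) (g : c.Group I) :
    0 < c.sliceProb istar θ g :=
  marginal_pos (c.jointTable_pos istar hθ) istar _ _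

/-- A function of the table of the group `g`, extended by `0` to the cells outside the slice of
this group. -/
noncomputable def onSlice (g : c.Group I) (F : Cell I (c.res g) → ℝ) (i : ∀ γ, I γ) : ℝ :=
  if (c.sep g).restrict i = c.slice g then F ((c.res g).restrict i) else 0

theorem sum_jointTable_mul_onSlice (θ : ∀ g : c.Group I, c.Coord istar g → ℝ) (g : c.Group I)
    (F : Cell I (c.res g) → ℝ) :
    ∑ i, c.jointTable istar θ i * c.onSlice g F i
      = c.sliceProb istar θ g * ∑ r, c.table istar θ g r * F r := by
  have key := c.isPerfectSequence.sum_chainProd_mul_slice istar (c.sum_tables istar θ)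
  rcases g with ⟨l, s⟩ | ⟨l, j, s⟩
  · exact key (.inl l) s F
  · exact key (.inr ⟨l, j⟩) s F

theorem sum_jointTable_mul_onSlice_mul_onSlice (θ : ∀ g : c.Group I, c.Coord istar g → ℝ)
    {g g' : c.Group I} (hgg' : g ≠ g') {F : Cell I (c.res g) → ℝ} {F' : Cell I (c.res g') → ℝ}
    (hF : ∑ r, c.table istar θ g r * F r = 0) (hF' : ∑ r, c.table istar θ g' r * F' r = 0) :
    ∑ i, c.jointTable istar θ i * (c.onSlice g F i * c.onSlice g' F' i) = 0 := by
  have key : ∀ (k k' : c.Block) (s : Cell I (c.blockSep k)) (s' : Cell I (c.blockSep k'))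
      (F : Cell I (c.blockRes k) → ℝ) (F' : Cell I (c.blockRes k') → ℝ),
      (⟨k, s⟩ : Σ k, Cell I (c.blockSep k)) ≠ ⟨k', s'⟩ →
      ∑ r, c.tables istar θ k s r * F r = 0 → ∑ r, c.tables istar θ k' s' r * F' r = 0 →
      ∑ i, c.jointTable istar θ i *
        ((if (c.blockSep k).restrict i = s then F ((c.blockRes k).restrict i) else 0) *
          (if (c.blockSep k').restrict i = s' then F' ((c.blockRes k').restrict i) else 0))
        = 0 := by
    intro k k' s s' F F' hne hF hF'
    by_cases hk : k = k'
    · subst hk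
      refine Finset.sum_eq_zero fun i _ => ?_
      have hs : s ≠ s' := fun e => hne (by rw [e])
      by_cases h1 : (c.blockSep k).restrict i = s
      · rw [if_neg (fun h2 => hs (h1.symm.trans h2)), mul_zero, mul_zero]
      · rw [if_neg h1, zero_mul, mul_zero]
    · refine c.isPerfectSequence.sum_chainProd_mul_mul_eq_zero istar (c.sum_tables istar θ) hk
        (d := fun t r => if t = s then F r else 0) (e := fun t r => if t = s' then F' r else 0)
        (fun t => ?_) fun t => ?_
      · by_cases ht : t = s
        · subst ht
          simpa using hF
        · simp [ht]
      · by_cases ht : t = s'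
        · subst ht
          simpa using hF'
        · simp [ht]
  rcases g with ⟨l, s⟩ | ⟨l, j, s⟩ <;> rcases g' with ⟨l', s'⟩ | ⟨l', j', s'⟩
  · refine key (.inl l) (.inl l') s s' F F' (fun e => hgg' ?_) hF hF'
    cases e
    rfl
  · exact key (.inl l) (.inr ⟨l', j'⟩) s s' F F' (fun e => by cases e) hF hF'
  · exact key (.inr ⟨l, j⟩) (.inl l') s s' F F' (fun e => by cases e) hF hF'
  · refine key (.inr ⟨l, j⟩) (.inr ⟨l', j'⟩) s s' F F' (fun e => hgg' ?_) hF hF'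
    cases e
    rfl

/-- The block of a group in the information matrix depends on the other groups only through
`sliceProb`, which in turn does not depend on the group itself. -/
theorem sliceProb_update (hθ : θ ∈ c.paramSpace istar) (g : c.Group I)
    (t : c.Coord istar g → ℝ) :
    c.sliceProb istar (Function.update θ g t) g = c.sliceProb istar θ g := by
  have key := fun k s => c.isPerfectSequence.marginal_chainProd_congr istar (c.sum_tables istar θ)
    (c.tables_pos istar hθ) (c.sum_tables istar (Function.update θ g t)) (l := k) (s := s)
  have htab : ∀ g', g' ≠ g →
      c.table istar (Function.update θ g t) g' = c.table istar θ g' := by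
    intro g' hg'
    rw [table_eq_fullTable, Function.update_of_ne hg', table_eq_fullTable]
  rcases g with ⟨l, s⟩ | ⟨l, j, s⟩
  · refine key (.inl l) s fun k x r hne => ?_
    rcases k with l' | y
    · exact congrFun (htab (.inl ⟨l', x⟩) fun e => hne (by cases e; rfl)) r
    · exact congrFun (htab (.inr ⟨y.1, y.2, x⟩) fun e => by cases e) r
  · refine key (.inr ⟨l, j⟩) s fun k x r hne => ?_
    rcases k with l' | y
    · exact congrFun (htab (.inl ⟨l', x⟩) fun e => by cases e) r
    · exact congrFun (htab (.inr ⟨y.1, y.2, x⟩) fun e => hne (by cases e; rfl)) r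

/-! ### The Fisher information matrix -/

theorem jointTable_eq_prod_group (θ : ∀ g : c.Group I, c.Coord istar g → ℝ) (i : ∀ γ, I γ) :
    c.jointTable istar θ i = ∏ g : c.Group I, if (c.sep g).restrict i = c.slice g then
      c.table istar θ g ((c.res g).restrict i) else 1 := by
  have key : ∀ k : c.Block,
      c.tables istar θ k ((c.blockSep k).restrict i) ((c.blockRes k).restrict i)
        = ∏ s, if (c.blockSep k).restrict i = s then
          c.tables istar θ k s ((c.blockRes k).restrict i) else 1 := fun k => by
    rw [Finset.prod_ite_eq, if_pos (Finset.mem_univ _)]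
  rw [jointTable, chainProd]
  simp only [key]
  simp only [Fintype.prod_sum_type, Fintype.prod_sigma]
  rfl

theorem differentiable_jointTable (i : ∀ γ, I γ) :
    Differentiable ℝ fun θ => c.jointTable istar θ i := by
  simp only [jointTable_eq_prod_group]
  refine differentiable_finsetProd _ fun g => ?_
  split_ifs with h
  · have hg : Differentiable ℝ fun θ : (∀ g : c.Group I, c.Coord istar g → ℝ) => θ g :=
      differentiable_pi.1 differentiable_id g
    exact (differentiable_fullTable (Finset.restrict (c.res g) istar) _).comp hg
  · exact differentiable_const _

/-- The logarithmic derivative of the joint probabilities in the direction of a free coordinate. -/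
noncomputable def cellScore (θ : ∀ g : c.Group I, c.Coord istar g → ℝ)
    (a : Σ g : c.Group I, c.Coord istar g) :
    (∀ γ, I γ) → ℝ :=
  c.onSlice a.1 fun r => tableDeriv _ a.2 r / c.table istar θ a.1 r

/-- The joint probabilities are affine in each free coordinate. -/
theorem jointTable_add_single (hθ : θ ∈ c.paramSpace istar)
    (a : Σ g : c.Group I, c.Coord istar g) (t : ℝ) (i : ∀ γ, I γ) :
    c.jointTable istar
        (θ + t • (Pi.single a.1 (Pi.single a.2 1) : ∀ g : c.Group I, c.Coord istar g → ℝ)) i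
      = c.jointTable istar θ i * (1 + t * c.cellScore istar θ a i) := by
  obtain ⟨g, r⟩ := a
  rw [jointTable_eq_prod_group, jointTable_eq_prod_group,
    ← Finset.mul_prod_erase _ _ (Finset.mem_univ g),
    ← Finset.mul_prod_erase _ _ (Finset.mem_univ g), mul_right_comm]
  congr 1
  · simp only [cellScore, onSlice]
    split_ifs with h
    · have hg : (θ + t • (Pi.single g (Pi.single r 1) : ∀ g : c.Group I, c.Coord istar g → ℝ)) g
          = θ g + t • Pi.single r 1 := by simp
      rw [table_eq_fullTable, hg, fullTable_add_single, ← table_eq_fullTable]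
      have := (c.table_pos istar hθ g ((c.res g).restrict i)).ne'
      field_simp
    · simp
  · refine Finset.prod_congr rfl fun g' hg' => ?_
    have hg : (θ + t • (Pi.single g (Pi.single r 1) : ∀ g : c.Group I, c.Coord istar g → ℝ)) g'
        = θ g' := by
      simp [Finset.ne_of_mem_erase hg']
    rw [table_eq_fullTable, hg, ← table_eq_fullTable]

theorem sum_table_mul_tableDeriv (hθ : θ ∈ c.paramSpace istar) (g : c.Group I)
    (r : c.Coord istar g) :
    ∑ x, c.table istar θ g x * (tableDeriv _ r x / c.table istar θ g x) = 0 := by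
  rw [← sum_tableDeriv _ r]
  refine Finset.sum_congr rfl fun x _ => ?_
  exact mul_div_cancel₀ _ (c.table_pos istar hθ g x).ne'

theorem sum_jointTable_mul_cellScore (hθ : θ ∈ c.paramSpace istar)
    (a : Σ g : c.Group I, c.Coord istar g) :
    ∑ i, c.jointTable istar θ i * c.cellScore istar θ a i = 0 := by
  rw [cellScore, sum_jointTable_mul_onSlice, c.sum_table_mul_tableDeriv istar hθ, mul_zero]

theorem isOpen_paramSpace : IsOpen (c.paramSpace istar) := by
  have : c.paramSpace istar = Set.univ.pi fun g => c.simplex istar g := by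
    ext θ
    simp [paramSpace]
  rw [this]
  exact isOpen_set_pi Set.finite_univ fun g _ => isOpen_openSimplex

theorem eventually_multinomialProb_joint (hθ : θ ∈ c.paramSpace istar) (n : (∀ γ, I γ) → ℕ) :
    (fun η => multinomialProb (c.joint istar η) n)
      =ᶠ[𝓝 θ] fun η => multinomialProb (c.jointTable istar η) n := by
  filter_upwards [(c.isOpen_paramSpace istar).mem_nhds hθ] with η hη
  rw [c.joint_eq_jointTable istar hη]

theorem multinomialProb_jointTable_pos (hθ : θ ∈ c.paramSpace istar) (n : (∀ γ, I γ) → ℕ) :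
    0 < multinomialProb (c.jointTable istar θ) n :=
  mul_pos (Nat.cast_pos.2 (Nat.multinomial_pos _ _))
    (Finset.prod_pos fun i _ => pow_pos (c.jointTable_pos istar hθ i) _)

theorem differentiable_multinomialProb_jointTable (n : (∀ γ, I γ) → ℕ) :
    Differentiable ℝ fun η => multinomialProb (c.jointTable istar η) n := by
  unfold multinomialProb
  exact (differentiable_const _).mul (differentiable_finsetProd _ fun i =>
    (c.differentiable_jointTable istar i).pow _)

theorem score_multinomialProb_joint (hθ : θ ∈ c.paramSpace istar) (n : (∀ γ, I γ) → ℕ)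
    (a : Σ g : c.Group I, c.Coord istar g) :
    score (fun n θ => multinomialProb (c.joint istar θ) n) n θ a
      = ∑ i, n i * c.cellScore istar θ a i := by
  have h0 : (fun η => Real.log (multinomialProb (c.joint istar η) n)) =ᶠ[𝓝 θ]
      fun η => Real.log (multinomialProb (c.jointTable istar η) n) :=
    (c.eventually_multinomialProb_joint istar hθ n).fun_comp Real.log
  rw [score, h0.fderiv_eq]
  have hpos := c.multinomialProb_jointTable_pos istar hθ n
  have hd : DifferentiableAt ℝ
      (fun η => Real.log (multinomialProb (c.jointTable istar η) n)) θ :=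
    (c.differentiable_multinomialProb_jointTable istar n θ).log hpos.ne'
  rw [← hd.lineDeriv_eq_fderiv, lineDeriv]
  have hf := fun t => funext (c.jointTable_add_single istar hθ a t)
  simp only [hf]
  have h1 := hasDerivAt_prod_one_add_pow (c.cellScore istar θ a) n
  have h2 := (h1.const_mul (multinomialProb (c.jointTable istar θ) n)).log (by simpa using hpos.ne')
  simp only [← multinomialProb_mul] at h2
  refine (h2.congr_deriv ?_).deriv
  simp only [zero_mul, add_zero, mul_one]
  rw [mul_div_cancel_left₀ _ hpos.ne']

theorem fisherInfo_eq_sum (hθ : θ ∈ c.paramSpace istar) (N : ℕ)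
    (a b : Σ g : c.Group I, c.Coord istar g) :
    fisherInfo (Finset.piAntidiag (Finset.univ : Finset (∀ γ, I γ)) N)
        (fun n θ => multinomialProb (c.joint istar θ) n) θ a b
      = N * ∑ i, c.jointTable istar θ i * (c.cellScore istar θ a i * c.cellScore istar θ b i) := by
  simp only [fisherInfo, Matrix.of_apply, c.score_multinomialProb_joint istar hθ,
    c.joint_eq_jointTable istar hθ]
  rw [sum_multinomialProb_mul_sum_mul_sum (c.sum_jointTable istar θ)
    (c.sum_jointTable_mul_cellScore istar hθ a)]
  simp only [mul_assoc]

theorem fisherInfo_of_ne (hθ : θ ∈ c.paramSpace istar) (N : ℕ)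
    {a b : Σ g : c.Group I, c.Coord istar g} (hab : a.1 ≠ b.1) :
    fisherInfo (Finset.piAntidiag (Finset.univ : Finset (∀ γ, I γ)) N)
        (fun n θ => multinomialProb (c.joint istar θ) n) θ a b = 0 := by
  rw [c.fisherInfo_eq_sum istar hθ, cellScore, cellScore,
    c.sum_jointTable_mul_onSlice_mul_onSlice istar θ hab (c.sum_table_mul_tableDeriv istar hθ _ _)
      (c.sum_table_mul_tableDeriv istar hθ _ _), mul_zero]

theorem fisherInfo_of_eq (hθ : θ ∈ c.paramSpace istar) (N : ℕ) (g : c.Group I)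
    (r r' : c.Coord istar g) :
    fisherInfo (Finset.piAntidiag (Finset.univ : Finset (∀ γ, I γ)) N)
        (fun n θ => multinomialProb (c.joint istar θ) n) θ ⟨g, r⟩ ⟨g, r'⟩
      = N * c.sliceProb istar θ g * ((if r = r' then (θ g r)⁻¹ else 0)
        + (c.table istar θ g (Finset.restrict (c.res g) istar))⁻¹) := by
  have h1 : ∀ i, c.cellScore istar θ ⟨g, r⟩ i * c.cellScore istar θ ⟨g, r'⟩ i
      = c.onSlice g (fun x => tableDeriv _ r x / c.table istar θ g x *
        (tableDeriv _ r' x / c.table istar θ g x)) i := by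
    intro i
    simp only [cellScore, onSlice]
    split_ifs <;> simp
  rw [c.fisherInfo_eq_sum istar hθ]
  simp only [h1]
  rw [sum_jointTable_mul_onSlice, mul_assoc]
  exact congrArg _ (congrArg _ (sum_tableDeriv_mul_tableDeriv _ (hθ g) r r'))

theorem posDef_fisherInfo (hθ : θ ∈ c.paramSpace istar) {N : ℕ} (hN : 0 < N) :
    (fisherInfo (Finset.piAntidiag (Finset.univ : Finset (∀ γ, I γ)) N)
        (fun n θ => multinomialProb (c.joint istar θ) n) θ).PosDef := by
  set T₀ : c.Group I → ℝ := fun g => c.table istar θ g (Finset.restrict (c.res g) istar) with hT₀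
  set w : c.Group I → ℝ := fun g => N * c.sliceProb istar θ g with hw
  have hwpos : ∀ g, 0 < w g := fun g => mul_pos (Nat.cast_pos.2 hN) (c.sliceProb_pos istar hθ g)
  have hT₀pos : ∀ g, 0 < T₀ g := fun g => c.table_pos istar hθ g _
  -- A diagonal matrix plus, for each group, a matrix of rank one.
  set B : Matrix (c.Group I) (Σ g : c.Group I, c.Coord istar g) ℝ :=
    Matrix.of fun g a => if g = a.1 then √(w g * (T₀ g)⁻¹) else 0 with hB
  have hM : fisherInfo (Finset.piAntidiag (Finset.univ : Finset (∀ γ, I γ)) N)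
        (fun n θ => multinomialProb (c.joint istar θ) n) θ
      = Matrix.diagonal (fun a => w a.1 * (θ a.1 a.2)⁻¹) + B.conjTranspose * B := by
    ext a b
    have hBB : (B.conjTranspose * B) a b = if a.1 = b.1 then w a.1 * (T₀ a.1)⁻¹ else 0 := by
      rw [Matrix.mul_apply]
      simp only [hB, Matrix.conjTranspose_apply, Matrix.of_apply, star_trivial, ite_mul, zero_mul,
        Finset.sum_ite_eq', Finset.mem_univ, if_true]
      split_ifs with h
      · exact Real.mul_self_sqrt (mul_pos (hwpos _) (inv_pos.2 (hT₀pos _))).le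
      · exact mul_zero _
    rw [Matrix.add_apply, hBB]
    obtain ⟨g, r⟩ := a
    obtain ⟨g', r'⟩ := b
    by_cases hg : g = g'
    · subst hg
      rw [c.fisherInfo_of_eq istar hθ]
      by_cases hr : r = r'
      · subst hr
        simp only [if_true, Matrix.diagonal_apply_eq, mul_add, hw, hT₀]
      · have : (⟨g, r⟩ : Σ g : c.Group I, c.Coord istar g) ≠ ⟨g, r'⟩ := by
          simpa using hr
        simp only [hr, if_true, if_false, Matrix.diagonal_apply_ne _ this, mul_add, mul_zero, hw,
          hT₀]
    · have : (⟨g, r⟩ : Σ g : c.Group I, c.Coord istar g) ≠ ⟨g', r'⟩ := fun e =>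
        hg (congrArg Sigma.fst e)
      rw [c.fisherInfo_of_ne istar hθ N (a := ⟨g, r⟩) (b := ⟨g', r'⟩) hg,
        Matrix.diagonal_apply_ne _ this, if_neg hg, add_zero]
  rw [hM]
  refine Matrix.PosDef.add_posSemidef (Matrix.PosDef.diagonal fun a => ?_)
    (Matrix.posSemidef_conjTranspose_mul_self B)
  exact mul_pos (hwpos _) (inv_pos.2 ((hθ a.1).1 a.2))

theorem isRegularModel {N : ℕ} (hN : 0 < N) :
    IsRegularModel (Finset.piAntidiag (Finset.univ : Finset (∀ γ, I γ)) N)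
      (fun n θ => multinomialProb (c.joint istar θ) n) (c.simplex istar) where
  pos θ hθ n _ := by
    rw [c.joint_eq_jointTable istar hθ]
    exact c.multinomialProb_jointTable_pos istar hθ n
  sum_eq_one θ hθ := by
    rw [sum_multinomialProb, c.joint_eq_jointTable istar hθ, c.sum_jointTable, one_pow]
  differentiableAt θ hθ n _ :=
    (c.differentiable_multinomialProb_jointTable istar n θ).congr_of_eventuallyEq
      (c.eventually_multinomialProb_joint istar hθ n)
  posDef θ hθ := c.posDef_fisherInfo istar hθ hN

end CutOrdering

end RefPrior

theorem theorem4p1 {V : Type*} [Fintype V] [DecidableEq V] (I : V → Type*)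
    [∀ γ, Fintype (I γ)] [∀ γ, DecidableEq (I γ)] (istar : ∀ γ, I γ)
    (G : SimpleGraph V) (hG : RefPrior.IsDecomposable G)
    (A : Finset V) (hA : RefPrior.IsCut I G A)
    (c : RefPrior.CutOrdering G A) (N : ℕ) (hN : 0 < N) :
    Set.BijOn (c.param istar) (RefPrior.markovModel G)
        {θ | ∀ g : c.Group I, θ g ∈ c.simplex istar g} ∧
      ∀ L : List (c.Group I), L.Nodup → (∀ g, g ∈ L) →
        RefPrior.IsReferencePrior
          (Finset.piAntidiag (Finset.univ : Finset (∀ γ, I γ)) N)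
          (fun n θ => RefPrior.multinomialProb (c.joint istar θ) n)
          (c.simplex istar) L (c.jeffreysProduct istar) := by
  refine ⟨c.bijOn_param istar, fun L hL hmem => ?_⟩
  refine RefPrior.isReferencePrior_of_orthogonal (c.isRegularModel istar hN)
    (w := fun g => RefPrior.tableWeight (Finset.restrict (c.res g) istar))
    (q := fun g θ => Fintype.card (c.Coord istar g) * Real.log (N * c.sliceProb istar θ g))
    (fun θ hθ a b hab => c.fisherInfo_of_ne istar hθ N hab) (fun θ hθ g => ?_)
    (fun g t ht => RefPrior.tableWeight_pos _ ht) (fun g => RefPrior.continuousOn_tableWeight _)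
    (fun θ hθ g t ht => ?_) (fun g => ?_) (fun g => RefPrior.volume_openSimplex_ne_zero)
    ⟨fun n g => RefPrior.innerSimplex _ n, fun n g => RefPrior.isCompact_innerSimplex n,
      fun n g => RefPrior.innerSimplex_subset_succ n, fun g => RefPrior.iUnion_innerSimplex⟩
    hL hmem fun θ hθ => ?_
  · have hpos : (0 : ℝ) < N * c.sliceProb istar θ g :=
      mul_pos (Nat.cast_pos.2 hN) (c.sliceProb_pos istar hθ g)
    rw [← RefPrior.log_det_table _ (hθ g), ← Real.log_pow, ← Real.log_mul]
    · rw [← Matrix.det_smul]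
      refine congrArg Real.log (congrArg Matrix.det ?_)
      ext r r'
      exact c.fisherInfo_of_eq istar hθ N g r r'
    · exact (pow_pos hpos _).ne'
    · rw [RefPrior.det_diagonal_add_const (fun r => ((hθ g).1 r).ne')
        (RefPrior.fullTable_pos _ (hθ g) _).ne'
        (by rw [RefPrior.fullTable_self, sub_add_cancel])]
      exact (mul_pos (inv_pos.2 (RefPrior.fullTable_pos _ (hθ g) _))
        (Finset.prod_pos fun r _ => inv_pos.2 ((hθ g).1 r))).ne'
  · simp only [c.sliceProb_update istar hθ]
  · refine ContinuousOn.mul continuousOn_const (ContinuousOn.log (Continuous.continuousOn ?_)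
      fun θ hθ => (mul_pos (Nat.cast_pos.2 hN) (c.sliceProb_pos istar hθ g)).ne')
    exact continuous_const.mul (continuous_finsetSum _ fun i _ =>
      (c.differentiable_jointTable istar i).continuous)
  · rw [Fintype.prod_sum_type, Fintype.prod_sigma, Fintype.prod_sigma]
    simp only [Fintype.prod_sigma]
    rfl
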